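/- **Theorem (Rees–Sharp).** Let $(R,\mathfrak m)$ be a Noetherian local ring of dimension $d\ge 2$ and let $I,J$ be $\mathfrak m$-primary ideals of $R$. For every $\mathfrak m$-primary ideal $K$, the length $\ell(R/K^n)$ agrees for all large $n$ with a polynomial in $n$ of degree $d$ with rational coefficients; write its leading coefficient as $e(K)/d!$. The length $\ell(R/I^rJ^s)$ agrees for all large $r$ and $s$ with a polynomial in $r,s$ of total degree $d$ with rational coefficients; write its homogeneous part of degree $d$ as $$\frac1{d!}\sum_{i=0}^{d}\binom di e_i\, r^{d-i}s^i .$$ Then the mixed multiplicities $e_0,\dots,e_d$ of $I$ and $J$ are positive, and $$\frac{e_1}{e_0}\le\frac{e_2}{e_1}\le\cdots\le\frac{e_d}{e_{d-1}} .$$ Moreover $$e_i^{\,d}\le e(I)^{d-i}\,e(J)^i\quad\text{for } i=0,1,\dots,d,$$ and Minkowski's inequality holds: $$e(IJ)^{1/d}\le e(I)^{1/d}+e(J)^{1/d}.$$ -/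

import Mathlib

open scoped Nat

noncomputable section

/-- An ideal of a local ring `(R, 𝔪)` is `𝔪`-primary if it is a primary ideal with radical `𝔪`. -/
def IsMaxPrimary {R : Type*} [CommRing R] [IsLocalRing R] (I : Ideal R) : Prop :=
  I.IsPrimary ∧ I.radical = IsLocalRing.maximalIdeal R

/-- `p` is the Hilbert polynomial of `I`: for all large `n`, the `R`-module `R / I ^ n` has finite
length, equal to `p(n)`. -/
def IsHilbertPolynomial {R : Type*} [CommRing R] (I : Ideal R) (p : Polynomial ℚ) : Prop :=
  ∃ N : ℕ, ∀ n : ℕ, N ≤ n →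
    ∃ l : ℕ, Module.length R (R ⧸ I ^ n) = (l : ℕ∞) ∧ p.eval (n : ℚ) = (l : ℚ)

/-- `P` is the Bhattacharya polynomial of `I` and `J`: for all large `r` and `s`, the `R`-module
`R / I ^ r J ^ s` has finite length, equal to `P(r, s)`. -/
def IsBhattacharyaPolynomial {R : Type*} [CommRing R] (I J : Ideal R)
    (P : MvPolynomial (Fin 2) ℚ) : Prop :=
  ∃ N : ℕ, ∀ r s : ℕ, N ≤ r → N ≤ s →
    ∃ l : ℕ, Module.length R (R ⧸ (I ^ r * J ^ s)) = (l : ℕ∞) ∧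
      MvPolynomial.eval ![(r : ℚ), (s : ℚ)] P = (l : ℚ)

/-- There is at most one Hilbert polynomial. -/
theorem IsHilbertPolynomial.unique {R : Type*} [CommRing R] {I : Ideal R} {p q : Polynomial ℚ}
    (hp : IsHilbertPolynomial I p) (hq : IsHilbertPolynomial I q) : p = q := by
  obtain ⟨M, hM⟩ := hp
  obtain ⟨N, hN⟩ := hq
  refine Polynomial.eq_of_infinite_eval_eq p q
    (((Set.Ici_infinite (max M N)).image (Nat.cast_injective (R := ℚ)).injOn).mono ?_)
  rintro _ ⟨n, hn, rfl⟩
  obtain ⟨k, hk, hpk⟩ := hM n (le_trans (le_max_left M N) hn)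
  obtain ⟨l, hl, hql⟩ := hN n (le_trans (le_max_right M N) hn)
  have hkl : k = l := by
    rw [hk] at hl
    exact_mod_cast hl
  simp [hpk, hql, hkl]

/-- There is at most one Bhattacharya polynomial. -/
theorem IsBhattacharyaPolynomial.unique {R : Type*} [CommRing R] {I J : Ideal R}
    {P Q : MvPolynomial (Fin 2) ℚ}
    (hP : IsBhattacharyaPolynomial I J P) (hQ : IsBhattacharyaPolynomial I J Q) : P = Q := by
  obtain ⟨M, hM⟩ := hP
  obtain ⟨N, hN⟩ := hQ
  refine MvPolynomial.funext_set (fun _ => (fun n : ℕ => (n : ℚ)) '' Set.Ici (max M N))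
    (fun _ => (Set.Ici_infinite (max M N)).image (Nat.cast_injective (R := ℚ)).injOn) ?_
  intro x hx
  obtain ⟨r, hr, hrx⟩ := hx 0 (Set.mem_univ _)
  obtain ⟨s, hs, hsx⟩ := hx 1 (Set.mem_univ _)
  have hx' : x = ![(r : ℚ), (s : ℚ)] := by
    ext i
    fin_cases i
    · exact hrx.symm
    · exact hsx.symm
  obtain ⟨k, hk, hpk⟩ := hM r s (le_trans (le_max_left M N) hr) (le_trans (le_max_left M N) hs)
  obtain ⟨l, hl, hql⟩ := hN r s (le_trans (le_max_right M N) hr) (le_trans (le_max_right M N) hs)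
  have hkl : k = l := by
    rw [hk] at hl
    exact_mod_cast hl
  rw [hx', hpk, hql, hkl]

open Classical in
/-- The Hilbert polynomial of `I` (`0` if there is none). -/
def hilbertSamuelPolynomial {R : Type*} [CommRing R] (I : Ideal R) : Polynomial ℚ :=
  if h : ∃ p, IsHilbertPolynomial I p then h.choose else 0

open Classical in
/-- The Bhattacharya polynomial of `I` and `J` (`0` if there is none). -/
def bhattacharyaPolynomial {R : Type*} [CommRing R] (I J : Ideal R) : MvPolynomial (Fin 2) ℚ :=
  if h : ∃ P, IsBhattacharyaPolynomial I J P then h.choose else 0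

/-- The multiplicity `e(I)` of an ideal `I` of a ring of dimension `d`: the coefficient of `n ^ d`
in the Hilbert polynomial of `I` is `e(I) / d!`. -/
def idealMultiplicity {R : Type*} [CommRing R] (d : ℕ) (I : Ideal R) : ℚ :=
  (d ! : ℚ) * (hilbertSamuelPolynomial I).coeff d

/-- The mixed multiplicity `e_i(I|J)` of two ideals of a ring of dimension `d`: the coefficient of
`r ^ (d - i) * s ^ i` in the Bhattacharya polynomial of `I` and `J` is
`(d.choose i) * e_i(I|J) / d!`. It is meant for `i ≤ d`. -/
def mixedMultiplicity {R : Type*} [CommRing R] (d : ℕ) (I J : Ideal R) (i : ℕ) : ℚ :=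
  (d ! : ℚ) / (d.choose i : ℚ) *
    (bhattacharyaPolynomial I J).coeff (Finsupp.single 0 (d - i) + Finsupp.single 1 i)

end

-- Write f(r,s) = ℓ(R/I^rJ^s) in the binomial basis as Σ c(a,b) C(r,a) C(s,b). The coefficients with
-- a + b = d are the mixed multiplicities, e_i = c(d-i,i), so every claim concerns the top
-- coefficients of f.
--
-- The engine is induction on d through superficial elements. If a ∈ I^k is superficial for the
-- filtration I^rJ^s, then for large r one has f(r+k,s) - f(r,s) = f'(r+k,s) - g, where f' is the
-- length function of R/(a), which has dimension d-1, and g = ℓ(0:a) is constant. Hence f is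
-- eventually polynomial, and when d ≥ 2 the top coefficients of f' are k·c(x+1,y)
-- (`HasBinomialCoeffs.eq_mul_of_isSuperficial`). Exchanging I and J reaches the coefficients with x
-- = 0. The residue field may be finite, so order k = 1 is not always available; prime avoidance in
-- the Noetherian bigraded Rees algebra gives superficial elements of every large order
-- (`exists_isSuperficial`).
--
-- Positivity descends to dimension one, where it follows from Nakayama's lemma. The inequality
-- e_{i+1}² ≤ e_i e_{i+2} descends to dimension two, since both sides scale by k². There, elements a
-- ∈ I^k and b ∈ I^l, superficial in succession, bound ℓ(R/I^rJ^s) by 2ℓ(R/J^s) plus the colength of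
-- an ideal containing powers of a and b. Asymptotically this reads 2uv e_1 ≤ u² e_0 + v² e_2 for
-- all positive integers u, v (`two_mul_le_of_dim_two`), and u : v = e_1 : e_0 gives e_1² ≤ e_0 e_2.
--
-- Log-convexity yields e_i^d ≤ e_0^(d-i) e_d^i. Comparison of colengths gives e_0 = e(I) and e_d =
-- e(J), and the diagonal r = s gives e(IJ) = Σ C(d,i) e_i; Minkowski's inequality is then the
-- binomial theorem applied term by term.

universe u

/-! ### Colengths of ideals and ideals containing a power of the maximal ideal. -/

section Colength

variable {R : Type*} [CommRing R]

/-- The colength of an ideal `X`, i.e. the length of `R ⧸ X`. -/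
noncomputable def colength (X : Submodule R R) : ℕ∞ := Module.length R (R ⧸ X)

theorem colength_anti {X Y : Submodule R R} (h : X ≤ Y) : colength Y ≤ colength X :=
  Module.length_le_of_surjective (Submodule.factor h) (Submodule.factor_surjective h)

/-- Multiplication by `a` makes 0 → R/(Y : a) → R/Y → R/(aR + Y) → 0 exact. -/
theorem colength_eq_colon_add (Y : Submodule R R) (a : R) :
    colength Y = colength (Y.colon {a}) + colength (Ideal.span {a} ⊔ Y : Submodule R R) := by
  have hle : (Y.colon {a} : Submodule R R) ≤ Y.comap (LinearMap.mulLeft R a) := by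
    intro y hy
    simpa [Submodule.mem_colon_singleton, mul_comm] using hy
  refine Module.length_eq_add_of_exact (Submodule.mapQ (Y.colon {a} : Submodule R R) Y (LinearMap.mulLeft R a) hle)
    (Submodule.mapQ Y (Ideal.span {a} ⊔ Y : Submodule R R) LinearMap.id le_sup_right) ?_
    (Submodule.factor_surjective _) ?_
  · rw [injective_iff_map_eq_zero]
    intro y hy
    obtain ⟨y, rfl⟩ := Submodule.mkQ_surjective _ y
    rw [Submodule.mkQ_apply, Submodule.mapQ_apply, Submodule.Quotient.mk_eq_zero] at hy
    rw [Submodule.mkQ_apply, Submodule.Quotient.mk_eq_zero]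
    simpa [Submodule.mem_colon_singleton, mul_comm] using hy
  · rw [LinearMap.exact_iff]
    ext z
    obtain ⟨z, rfl⟩ := Submodule.mkQ_surjective _ z
    rw [LinearMap.mem_ker, LinearMap.mem_range]
    rw [Submodule.mkQ_apply, Submodule.mapQ_apply, Submodule.Quotient.mk_eq_zero, LinearMap.id_apply]
    constructor
    · intro h
      obtain ⟨w, hw, y, hy, rfl⟩ := Submodule.mem_sup.1 h
      obtain ⟨t, rfl⟩ := Ideal.mem_span_singleton'.1 hw
      refine ⟨Submodule.Quotient.mk t, ?_⟩
      rw [Submodule.mapQ_apply, Submodule.Quotient.eq]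
      simpa [mul_comm] using hy
    · rintro ⟨t, ht⟩
      obtain ⟨t, rfl⟩ := Submodule.mkQ_surjective _ t
      rw [Submodule.mkQ_apply, Submodule.mapQ_apply, Submodule.Quotient.eq] at ht
      rw [← sub_sub_cancel (LinearMap.mulLeft R a t) z]
      exact Ideal.sub_mem _ (Ideal.mem_sup_left (Ideal.mem_span_singleton'.2 ⟨t, by simp [mul_comm]⟩))
        (Ideal.mem_sup_right ht)

/-- The colon of (a^(n+1)) + Y by `a` contains (a^n) + Y, so each further factor `a` costs at most
ℓ(R/(aR + Y)). -/
theorem colength_span_pow_sup_le (Y : Ideal R) (a : R) (n : ℕ) :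
    colength (Ideal.span {a ^ n} ⊔ Y) ≤ n * colength (Ideal.span {a} ⊔ Y) := by
  induction n with
  | zero =>
    simp [colength, Ideal.span_singleton_one, Module.length_eq_zero]
  | succ n ih =>
    rw [colength_eq_colon_add _ a, Nat.cast_succ, add_mul, one_mul]
    refine add_le_add ((colength_anti ?_).trans ih) (colength_anti ?_)
    · refine sup_le ?_ ?_
      · rw [Ideal.span_singleton_le_iff_mem, Submodule.mem_colon_singleton, smul_eq_mul, ← pow_succ]
        exact Ideal.mem_sup_left (Ideal.mem_span_singleton_self _)
      · intro y hy
        rw [Submodule.mem_colon_singleton]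
        exact Ideal.mem_sup_right (Ideal.mul_mem_right _ _ hy)
    · exact sup_le le_sup_left (le_sup_right.trans le_sup_right)

/-- Adjoin `x` and then `y` to the ideal: each colon that occurs contains `X`, so each step costs at
most ℓ(R/X). -/
theorem colength_span_pair_mul_sup_le (X Z : Ideal R) (x y : R) :
    colength (Ideal.span {x, y} * X ⊔ Z) ≤ 2 * colength X + colength (Ideal.span {x, y} ⊔ Z) := by
  have key : ∀ (w : R) (U : Ideal R), (∀ t ∈ X, w * t ∈ U) →
      colength U ≤ colength X + colength (Ideal.span {w} ⊔ U) := by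
    intro w U h
    rw [colength_eq_colon_add U w]
    gcongr
    refine colength_anti fun t ht => ?_
    rw [Submodule.mem_colon_singleton, smul_eq_mul, mul_comm]
    exact h t ht
  refine (key x _ fun t ht => Ideal.mem_sup_left (Ideal.mul_mem_mul
    (Ideal.subset_span (by simp)) ht)).trans ?_
  rw [two_mul, add_assoc]
  gcongr
  refine (key y _ fun t ht => Ideal.mem_sup_right (Ideal.mem_sup_left (Ideal.mul_mem_mul
    (Ideal.subset_span (by simp)) ht))).trans ?_
  gcongr
  refine colength_anti ?_
  rw [Ideal.span_insert x, sup_assoc, sup_left_comm]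
  exact sup_le_sup_left (sup_le_sup_left le_sup_right _) _

/-- Since Z ∩ Y = 0, the ideal `Z` embeds in R/Y, with cokernel R/(Z + Y). -/
theorem colength_eq_add_length_of_inf_eq_bot {Y Z : Submodule R R} (h : Z ⊓ Y = ⊥) :
    colength Y = colength (Z ⊔ Y) + Module.length R Z := by
  rw [add_comm]
  refine Module.length_eq_add_of_exact ((Submodule.mkQ Y).comp Z.subtype)
    (Submodule.mapQ Y (Z ⊔ Y) LinearMap.id le_sup_right) ?_ (Submodule.factor_surjective _) ?_
  · rw [← LinearMap.ker_eq_bot, LinearMap.ker_comp, Submodule.ker_mkQ, eq_bot_iff]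
    intro z hz
    have : (z : R) ∈ Z ⊓ Y := ⟨z.2, hz⟩
    rw [h] at this
    exact Subtype.ext this
  · rw [LinearMap.exact_iff]
    ext z
    obtain ⟨z, rfl⟩ := Submodule.mkQ_surjective _ z
    rw [LinearMap.mem_ker, LinearMap.mem_range]
    rw [Submodule.mkQ_apply, Submodule.mapQ_apply, Submodule.Quotient.mk_eq_zero, LinearMap.id_apply]
    constructor
    · intro h
      obtain ⟨w, hw, y, hy, rfl⟩ := Submodule.mem_sup.1 h
      refine ⟨⟨w, hw⟩, ?_⟩
      simp only [LinearMap.comp_apply, Submodule.subtype_apply, Submodule.mkQ_apply]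
      rw [Submodule.Quotient.eq]
      simpa using hy
    · rintro ⟨t, ht⟩
      simp only [LinearMap.comp_apply, Submodule.subtype_apply, Submodule.mkQ_apply] at ht
      rw [Submodule.Quotient.eq] at ht
      rw [← sub_sub_cancel (t : R) z]
      exact Ideal.sub_mem _ (Ideal.mem_sup_left t.2) (Ideal.mem_sup_right ht)

theorem length_le_colength_of_inf_eq_bot {Y Z : Ideal R} (h : Z ⊓ Y = ⊥) :
    Module.length R Z ≤ colength Y := by
  rw [colength_eq_add_length_of_inf_eq_bot h]
  exact le_add_self

theorem colength_map_quotient (A X : Ideal R) :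
    colength (X.map (Ideal.Quotient.mk A)) = colength (A ⊔ X) := by
  unfold colength
  rw [← Module.length_eq_of_surjective (S := R) (R := R ⧸ A) Ideal.Quotient.mk_surjective]
  exact (DoubleQuot.quotQuotEquivQuotSupₐ R A X).toLinearEquiv.length_eq

/-- For a ∈ Y, the colon X : a must have colength zero; otherwise R/X would be strictly longer than
R/Y. -/
theorem eq_of_colength_eq {X Y : Ideal R} (h : X ≤ Y) (hX : colength X ≠ ⊤)
    (he : colength X = colength Y) : X = Y := by
  refine le_antisymm h fun a ha => ?_
  have h1 := colength_eq_colon_add X a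
  have h2 : colength Y ≤ colength (Ideal.span {a} ⊔ X) :=
    colength_anti (sup_le ((Ideal.span_singleton_le_iff_mem _).2 ha) h)
  rw [he] at h1 hX
  have h3 : colength (X.colon {a}) = 0 := by
    by_contra h0
    have : colength Y < colength (X.colon {a}) + colength (Ideal.span {a} ⊔ X) := by
      refine lt_of_lt_of_le ?_ (add_le_add_right h2 _)
      exact ENat.lt_add_left hX (pos_iff_ne_zero.2 h0)
    exact this.ne h1
  unfold colength at h3
  rw [Module.length_eq_zero_iff, Submodule.Quotient.subsingleton_iff] at h3
  have : (1 : R) ∈ X.colon {a} := h3 ▸ Submodule.mem_top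
  simpa [Submodule.mem_colon_singleton] using this

/-- An ideal of a local ring is contained in the maximal ideal and contains a power of it. -/
def IsCofinite [IsLocalRing R] (I : Ideal R) : Prop :=
  I ≤ IsLocalRing.maximalIdeal R ∧ ∃ n, IsLocalRing.maximalIdeal R ^ n ≤ I

theorem IsMaxPrimary.isCofinite [IsLocalRing R] [IsNoetherianRing R] {I : Ideal R}
    (h : IsMaxPrimary I) : IsCofinite I := by
  refine ⟨h.2 ▸ Ideal.le_radical, ?_⟩
  rw [← h.2]
  exact I.exists_radical_pow_le_of_fg (IsNoetherian.noetherian _)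

theorem maximalIdeal_quotient_le_map [IsLocalRing R] (A : Ideal R) [IsLocalRing (R ⧸ A)] :
    IsLocalRing.maximalIdeal (R ⧸ A) ≤
      (IsLocalRing.maximalIdeal R).map (Ideal.Quotient.mk A) := by
  intro z hz
  obtain ⟨z, rfl⟩ := Ideal.Quotient.mk_surjective z
  exact Ideal.mem_map_of_mem _ (fun h => hz (h.map _))

theorem IsCofinite.map_quotient [IsLocalRing R] {I : Ideal R} (h : IsCofinite I) (A : Ideal R)
    [IsLocalRing (R ⧸ A)] : IsCofinite (I.map (Ideal.Quotient.mk A)) := by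
  obtain ⟨h1, n, h2⟩ := h
  refine ⟨?_, n, ?_⟩
  · rw [Ideal.map_le_iff_le_comap]
    intro x hx hu
    have hloc : IsLocalHom (Ideal.Quotient.mk A) :=
      .of_surjective _ Ideal.Quotient.mk_surjective
    exact h1 hx (hloc.map_nonunit x hu)
  · refine (Ideal.pow_right_mono (maximalIdeal_quotient_le_map A) n).trans ?_
    rw [← Ideal.map_pow]
    exact Ideal.map_mono h2

theorem IsCofinite.mul [IsLocalRing R] {I J : Ideal R} (hI : IsCofinite I) (hJ : IsCofinite J) :
    IsCofinite (I * J) := by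
  obtain ⟨h1, n, h2⟩ := hI
  obtain ⟨-, m, h3⟩ := hJ
  exact ⟨Ideal.mul_le_left.trans h1, n + m, pow_add (IsLocalRing.maximalIdeal R) n m ▸
    Ideal.mul_mono h2 h3⟩

theorem IsCofinite.exists_pow_le_pow_mul_pow [IsLocalRing R] {I J : Ideal R} (hI : IsCofinite I)
    (hJ : IsCofinite J) (r s : ℕ) : ∃ n, IsLocalRing.maximalIdeal R ^ n ≤ I ^ r * J ^ s := by
  obtain ⟨h1, n, h2⟩ := hI
  obtain ⟨-, m, h3⟩ := hJ
  refine ⟨n * r + m * s, ?_⟩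
  rw [pow_add, pow_mul, pow_mul]
  exact Ideal.mul_mono (Ideal.pow_right_mono h2 _) (Ideal.pow_right_mono h3 _)

theorem colength_ne_top_of_pow_le [IsLocalRing R] [IsNoetherianRing R] {X : Ideal R} {n : ℕ}
    (h : IsLocalRing.maximalIdeal R ^ n ≤ X) : colength X ≠ ⊤ := by
  by_cases hX : X = ⊤
  · subst hX
    simp [colength, Module.length_eq_zero]
  have : Nontrivial (R ⧸ X) := Ideal.Quotient.nontrivial_iff.2 hX
  have : IsLocalRing (R ⧸ X) :=
    IsLocalRing.of_surjective' (Ideal.Quotient.mk X) Ideal.Quotient.mk_surjective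
  have : IsArtinianRing (R ⧸ X) := by
    rw [isArtinianRing_iff_isNilpotent_maximalIdeal]
    refine ⟨n, ?_⟩
    refine eq_bot_iff.2 ((Ideal.pow_right_mono (maximalIdeal_quotient_le_map X) n).trans ?_)
    rw [← Ideal.map_pow, ← Ideal.map_quotient_self X]
    exact Ideal.map_mono h
  unfold colength
  rw [Module.length_eq_of_surjective (S := R) (R := R ⧸ X) Ideal.Quotient.mk_surjective]
  exact Module.length_ne_top

theorem IsCofinite.colength_ne_top [IsLocalRing R] [IsNoetherianRing R] {I J : Ideal R}
    (hI : IsCofinite I) (hJ : IsCofinite J) (r s : ℕ) : colength (I ^ r * J ^ s) ≠ ⊤ :=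
  colength_ne_top_of_pow_le (hI.exists_pow_le_pow_mul_pow hJ r s).choose_spec

end Colength

/-! ### Prime avoidance by homogeneous elements of prescribed degree. -/

section Avoidance

/-- The primes need not be homogeneous, so incomparability is tested on homogeneous elements only.
An element of degree one outside a prime supplies the powers that adjust degrees, which is why every
large degree is reached. -/
theorem exists_mem_graded_notMem_of_isPrime {E : Type*} [CommRing E] (W : ℕ → AddSubgroup E)
    (hone : (1 : E) ∈ W 0) (hmul : ∀ j k x y, x ∈ W j → y ∈ W k → x * y ∈ W (j + k))
    (s : Finset (Ideal E)) (hs : ∀ P ∈ s, P.IsPrime) (hW : ∀ P ∈ s, ∃ x ∈ W 1, x ∉ P) :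
    ∃ k₀, ∀ k ≥ k₀, ∃ x ∈ W k, ∀ P ∈ s, x ∉ P := by
  classical
  have hpow : ∀ v ∈ W 1, ∀ n, v ^ n ∈ W n := by
    intro v hv n
    induction n with
    | zero => simpa using hone
    | succ n ih => rw [pow_succ]; exact hmul _ _ _ _ ih hv
  have hprod : ∀ (t : Finset (Ideal E)) (e : Ideal E → ℕ) (g : Ideal E → E),
      (∀ P ∈ t, g P ∈ W (e P)) → ∏ P ∈ t, g P ∈ W (∑ P ∈ t, e P) := by
    intro t e g
    induction t using Finset.induction_on with
    | empty => intro; simpa using hone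
    | insert P t hP ih =>
      intro h
      rw [Finset.prod_insert hP, Finset.sum_insert hP]
      exact hmul _ _ _ _ (h P (by simp)) (ih fun Q hQ => h Q (by simp [hQ]))
  induction s using Finset.strongInduction with
  | H s ih =>
    have ih' : ∀ P ∈ s, ∃ k₀, ∀ k ≥ k₀, ∃ x ∈ W k, ∀ Q ∈ s.erase P, x ∉ Q := fun P hP =>
      ih _ (Finset.erase_ssubset hP) (fun Q hQ => hs Q (Finset.mem_of_mem_erase hQ))
        (fun Q hQ => hW Q (Finset.mem_of_mem_erase hQ))
    -- If all homogeneous elements of `P` lie in `Q`, then avoiding `Q` already avoids `P`, and `P`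
    -- may be dropped.
    by_cases hc : ∃ P ∈ s, ∃ Q ∈ s, P ≠ Q ∧ ∀ k, ∀ x ∈ W k, x ∈ P → x ∈ Q
    · obtain ⟨P, hP, Q, hQ, hne, hPQ⟩ := hc
      obtain ⟨k₀, h⟩ := ih' P hP
      refine ⟨k₀, fun k hk => ?_⟩
      obtain ⟨x, hx, hx'⟩ := h k hk
      refine ⟨x, hx, fun T hT hxT => ?_⟩
      by_cases hTP : T = P
      · exact hx' Q (Finset.mem_erase.2 ⟨hne.symm, hQ⟩) (hPQ k x hx (hTP ▸ hxT))
      · exact hx' T (Finset.mem_erase.2 ⟨hTP, hT⟩) hxT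
    · push Not at hc
      obtain rfl | ⟨Q, hQ⟩ := s.eq_empty_or_nonempty
      · exact ⟨0, fun k _ => ⟨0, zero_mem _, by simp⟩⟩
      have hQp := hs Q hQ
      obtain ⟨k₀, h⟩ := ih' Q hQ
      have hch : ∀ P : Ideal E, ∃ (k : ℕ) (x : E), P ∈ s.erase Q → x ∈ W k ∧ x ∈ P ∧ x ∉ Q := by
        intro P
        by_cases hP : P ∈ s.erase Q
        · obtain ⟨k, x, h1, h2, h3⟩ :=
            hc P (Finset.mem_of_mem_erase hP) Q hQ (Finset.ne_of_mem_erase hP)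
          exact ⟨k, x, fun _ => ⟨h1, h2, h3⟩⟩
        · exact ⟨0, 0, fun h => absurd h hP⟩
      choose e g hg using hch
      obtain ⟨v, hv, hvQ⟩ := hW Q hQ
      -- The product `b` lies in every prime but `Q`. If an element `x` avoiding the others falls
      -- into `Q`, adding `b * v ^ (k - j)` moves it out of `Q`, changes nothing modulo the others
      -- and keeps degree `k`.
      set b := ∏ P ∈ s.erase Q, g P with hb
      have hbW := hprod (s.erase Q) e g fun P hP => (hg P hP).1
      have hbQ : b ∉ Q := by
        rw [hb, hQp.prod_mem_iff]
        rintro ⟨P, hP, h⟩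
        exact (hg P hP).2.2 h
      set j := ∑ P ∈ s.erase Q, e P
      refine ⟨max k₀ j, fun k hk => ?_⟩
      obtain ⟨x, hx, hx'⟩ := h k (le_of_max_le_left hk)
      by_cases hxQ : x ∈ Q
      · refine ⟨x + b * v ^ (k - j), add_mem hx ?_, fun P hP hmem => ?_⟩
        · have := hmul _ _ _ _ hbW (hpow v hv (k - j))
          rwa [Nat.add_sub_cancel' (le_of_max_le_right hk)] at this
        · by_cases hPQ : P = Q
          · subst hPQ
            rcases hQp.mem_or_mem ((Ideal.add_mem_iff_right _ hxQ).1 hmem) with h1 | h1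
            · exact hbQ h1
            · exact hvQ (hQp.mem_of_pow_mem _ h1)
          · have hP' := Finset.mem_erase.2 ⟨hPQ, hP⟩
            refine hx' P hP' ((Ideal.add_mem_iff_left _ (Ideal.mul_mem_right _ _ ?_)).1 hmem)
            rw [hb, ← Finset.mul_prod_erase _ _ hP']
            exact Ideal.mul_mem_right _ _ (hg P hP').2.1
      · refine ⟨x, hx, fun P hP => ?_⟩
        by_cases hPQ : P = Q
        · exact hPQ ▸ hxQ
        · exact hx' P (Finset.mem_erase.2 ⟨hPQ, hP⟩)

end Avoidance

/-! ### The bigraded Rees algebra and existence of superficial elements. -/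

section BiRees

open MvPolynomial

variable {R : Type*} [CommRing R] (I J : Ideal R)

/-- The bigraded Rees algebra of two ideals. -/
def biRees : Subalgebra R (MvPolynomial (Fin 2) R) where
  carrier := {f | ∀ m, f.coeff m ∈ I ^ m 0 * J ^ m 1}
  mul_mem' := by
    intro f g hf hg m
    rw [coeff_mul]
    refine Ideal.sum_mem _ fun p hp => ?_
    rw [Finset.HasAntidiagonal.mem_antidiagonal] at hp
    rw [← hp, Finsupp.add_apply, Finsupp.add_apply, pow_add, pow_add, mul_mul_mul_comm]
    exact Ideal.mul_mem_mul (hf _) (hg _)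
  add_mem' := fun hf hg m => by
    rw [coeff_add]
    exact add_mem (hf m) (hg m)
  algebraMap_mem' := fun c m => by
    rw [algebraMap_eq, coeff_C]
    split_ifs with h
    · simp [← h]
    · exact zero_mem _

variable {I J}

theorem biRees.monomial_mem {m : Fin 2 →₀ ℕ} {y : R} (hy : y ∈ I ^ m 0 * J ^ m 1) :
    monomial m y ∈ biRees I J := by
  classical
  intro n
  rw [coeff_monomial]
  split_ifs with h
  · exact h ▸ hy
  · exact zero_mem _

theorem monomial_mem_of_mem_pow {A : Subalgebra R (MvPolynomial (Fin 2) R)} {K : Ideal R}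
    {i : Fin 2} (h : ∀ y ∈ K, monomial (Finsupp.single i 1) y ∈ A) (r : ℕ) {y : R}
    (hy : y ∈ K ^ r) : monomial (Finsupp.single i r) y ∈ A := by
  induction r generalizing y with
  | zero =>
    rw [Finsupp.single_zero]
    exact A.algebraMap_mem y
  | succ r ih =>
    rw [pow_succ] at hy
    refine Submodule.mul_induction_on hy (fun a ha b hb => ?_) (fun a b ha hb => ?_)
    · rw [Finsupp.single_add, ← monomial_mul]
      exact mul_mem (ih ha) (h b hb)
    · rw [map_add]
      exact add_mem ha hb

theorem monomial_mem_adjoin {K : Ideal R} {G : Set R} (hG : Ideal.span G = K) {i : Fin 2}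
    {S : Set (MvPolynomial (Fin 2) R)} (hS : ∀ y ∈ G, monomial (Finsupp.single i 1) y ∈ S)
    {y : R} (hy : y ∈ K) : monomial (Finsupp.single i 1) y ∈ Algebra.adjoin R S := by
  rw [← hG] at hy
  refine Submodule.span_induction (fun x hx => Algebra.subset_adjoin (hS x hx)) ?_ ?_ ?_ hy
  · rw [map_zero]
    exact zero_mem _
  · intro a b _ _ ha hb
    rw [map_add]
    exact add_mem ha hb
  · intro a b _ hb
    rw [map_smul]
    exact Subalgebra.smul_mem _ hb a

theorem biRees.fg [IsNoetherianRing R] : (biRees I J).FG := by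
  classical
  obtain ⟨G, hG⟩ := (IsNoetherian.noetherian I : I.FG)
  obtain ⟨H, hH⟩ := (IsNoetherian.noetherian J : J.FG)
  let S : Finset (MvPolynomial (Fin 2) R) := G.image (monomial (Finsupp.single 0 1)) ∪
    H.image (monomial (Finsupp.single 1 1))
  refine ⟨S, le_antisymm (Algebra.adjoin_le ?_) ?_⟩
  · intro f hf
    simp only [S, Finset.coe_union, Finset.coe_image, Set.mem_union, Set.mem_image] at hf
    rcases hf with ⟨a, ha, rfl⟩ | ⟨b, hb, rfl⟩
    · refine monomial_mem ?_
      simpa using hG ▸ Ideal.subset_span ha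
    · refine monomial_mem ?_
      simpa using hH ▸ Ideal.subset_span hb
  · intro f hf
    rw [f.as_sum]
    refine sum_mem fun m _ => ?_
    refine Submodule.mul_induction_on (hf m) (fun a ha b hb => ?_) (fun a b ha hb => ?_)
    · have hm : m = Finsupp.single 0 (m 0) + Finsupp.single 1 (m 1) := by
        ext i
        fin_cases i <;> simp
      rw [hm, ← monomial_mul]
      refine mul_mem (monomial_mem_of_mem_pow (fun y hy => monomial_mem_adjoin hG ?_ hy) _ ?_)
        (monomial_mem_of_mem_pow (fun y hy => monomial_mem_adjoin hH ?_ hy) _ ?_)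
      · intro y hy
        simp only [S, Finset.coe_union, Finset.coe_image]
        exact Or.inl ⟨y, hy, rfl⟩
      · simpa using ha
      · intro y hy
        simp only [S, Finset.coe_union, Finset.coe_image]
        exact Or.inr ⟨y, hy, rfl⟩
      · simpa using hb
    · rw [map_add]
      exact add_mem ha hb

instance [IsNoetherianRing R] : IsNoetherianRing (biRees I J) :=
  have : Algebra.FiniteType R (biRees I J) := ⟨(biRees I J).fg_top.2 biRees.fg⟩
  Algebra.FiniteType.isNoetherianRing R _

namespace biRees

/-- The homogeneous element of the bigraded Rees algebra given by an element of `I ^ r * J ^ s`. -/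
noncomputable def mon (m : Fin 2 →₀ ℕ) (y : R) (hy : y ∈ I ^ m 0 * J ^ m 1) : biRees I J :=
  ⟨monomial m y, monomial_mem hy⟩

/-- With `mon_mem_map`, this identifies the part of bidegree (r,s) of the extension of `L` with
I^rJ^sL. For L = I or L = J, membership in the extension means lying one step deeper in the
filtration. -/
theorem coeff_mem_of_mem_map {L : Ideal R} {x : biRees I J}
    (hx : x ∈ L.map (algebraMap R (biRees I J))) (m : Fin 2 →₀ ℕ) :
    (x : MvPolynomial (Fin 2) R).coeff m ∈ I ^ m 0 * J ^ m 1 * L := by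
  have hx' : x ∈ (L • ⊤ : Submodule R (biRees I J)) := by rwa [Ideal.smul_top_eq_map]
  refine Submodule.smul_induction_on hx' (fun c hc n _ => ?_) (fun y z hy hz => ?_)
  · rw [Subalgebra.coe_smul, coeff_smul, smul_eq_mul, mul_comm c]
    exact Ideal.mul_mem_mul (n.2 m) hc
  · rw [Subalgebra.coe_add, coeff_add]
    exact add_mem hy hz

theorem mon_mem_map {m : Fin 2 →₀ ℕ} {L : Ideal R} {y : R} (hy₀ : y ∈ I ^ m 0 * J ^ m 1)
    (hy : y ∈ I ^ m 0 * J ^ m 1 * L) : mon m y hy₀ ∈ L.map (algebraMap R (biRees I J)) := by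
  have : ∃ x ∈ L.map (algebraMap R (biRees I J)), (x : MvPolynomial (Fin 2) R) = monomial m y := by
    refine Submodule.mul_induction_on hy (fun a ha b hb => ?_) (fun a b ha hb => ?_)
    · refine ⟨algebraMap R (biRees I J) b * mon m a ha,
        Ideal.mul_mem_right _ _ (Ideal.mem_map_of_mem _ hb), ?_⟩
      rw [Subalgebra.coe_mul, Subalgebra.coe_algebraMap, MvPolynomial.algebraMap_eq, mon,
        C_mul_monomial, mul_comm]
    · obtain ⟨x, hx, hx'⟩ := ha
      obtain ⟨z, hz, hz'⟩ := hb
      exact ⟨x + z, add_mem hx hz, by rw [Subalgebra.coe_add, hx', hz', map_add]⟩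
  obtain ⟨x, hx, hx'⟩ := this
  rwa [show mon m y hy₀ = x from Subtype.ext hx'.symm]

/-- The elements of bidegree `(k, 0)` of the bigraded Rees algebra. -/
noncomputable def degreeLeft (I J : Ideal R) (k : ℕ) : AddSubgroup (biRees I J) where
  carrier := {x | ∃ a ∈ I ^ k, (x : MvPolynomial (Fin 2) R) = monomial (Finsupp.single 0 k) a}
  zero_mem' := ⟨0, zero_mem _, by simp⟩
  add_mem' := by
    rintro _ _ ⟨a, ha, ha'⟩ ⟨b, hb, hb'⟩
    exact ⟨a + b, add_mem ha hb, by simp [ha', hb']⟩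
  neg_mem' := by
    rintro _ ⟨a, ha, ha'⟩
    exact ⟨-a, neg_mem ha, by simp [ha']⟩

theorem one_mem_degreeLeft : (1 : biRees I J) ∈ degreeLeft I J 0 :=
  ⟨1, by simp, by rw [Finsupp.single_zero]; rfl⟩

theorem mul_mem_degreeLeft (j k : ℕ) (x y : biRees I J) (hx : x ∈ degreeLeft I J j)
    (hy : y ∈ degreeLeft I J k) : x * y ∈ degreeLeft I J (j + k) := by
  obtain ⟨a, ha, ha'⟩ := hx
  obtain ⟨b, hb, hb'⟩ := hy
  refine ⟨a * b, pow_add I j k ▸ Ideal.mul_mem_mul ha hb, ?_⟩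
  rw [Subalgebra.coe_mul, ha', hb', monomial_mul, Finsupp.single_add]

/-- Homogeneous elements of large left degree lie in powers of the ideal generated by the elements
of bidegree `(1, 0)`. -/
theorem mon_mem_span_degreeLeft_pow (c : ℕ) {m : Fin 2 →₀ ℕ} (hm : c ≤ m 0) {y : R}
    (hy : y ∈ I ^ m 0 * J ^ m 1) :
    mon m y hy ∈ Ideal.span (degreeLeft I J 1 : Set (biRees I J)) ^ c := by
  induction c generalizing m y with
  | zero => simp
  | succ c ih =>
    have : ∃ x ∈ Ideal.span (degreeLeft I J 1 : Set (biRees I J)) ^ (c + 1),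
        (x : MvPolynomial (Fin 2) R) = monomial m y := by
      obtain ⟨n, rfl⟩ : ∃ n, m = Finsupp.single 0 1 + n :=
        le_iff_exists_add.1 (Finsupp.single_le_iff.2 (by omega))
      have hn : c ≤ n 0 := by
        simp at hm
        omega
      have hy' : y ∈ I * (I ^ n 0 * J ^ n 1) := by
        convert hy using 1
        simp [pow_add, mul_assoc]
      refine Submodule.mul_induction_on hy' (fun a ha b hb => ?_) (fun a b ha hb => ?_)
      · refine ⟨mon (Finsupp.single 0 1) a (by simpa using ha) * mon n b hb, ?_, ?_⟩
        · rw [pow_succ']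
          exact Ideal.mul_mem_mul (Ideal.subset_span ⟨a, by simpa using ha, rfl⟩) (ih hn hb)
        · rw [Subalgebra.coe_mul, mon, mon, monomial_mul]
      · obtain ⟨x, hx, hx'⟩ := ha
        obtain ⟨z, hz, hz'⟩ := hb
        exact ⟨x + z, add_mem hx hz, by rw [Subalgebra.coe_add, hx', hz', map_add]⟩
    obtain ⟨x, hx, hx'⟩ := this
    rwa [show mon m y hy = x from Subtype.ext hx'.symm]

/-- Elements of large left degree that are multiplied into `Q` by a homogeneous element `x`
avoiding the relevant associated primes of `Q` lie in `Q`. -/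
theorem exists_primes_forall_mem [IsNoetherianRing R] (Q : Ideal (biRees I J)) :
    ∃ (s : Finset (Ideal (biRees I J))) (c : ℕ), (∀ P ∈ s, P.IsPrime) ∧
      (∀ P ∈ s, ∃ x ∈ degreeLeft I J 1, x ∉ P) ∧
      ∀ x, (∀ P ∈ s, x ∉ P) → ∀ (m : Fin 2 →₀ ℕ) (_ : c ≤ m 0) (y : R)
        (hy : y ∈ I ^ m 0 * J ^ m 1), x * mon m y hy ∈ Q → mon m y hy ∈ Q := by
  classical
  -- A primary decomposition of `Q`. A component whose radical contains all elements of bidegree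
  -- (1,0) contains everything of large left degree; only the radicals of the other components have
  -- to be avoided.
  obtain ⟨t, ht, htp⟩ := Submodule.isLasker (biRees I J) (biRees I J) Q
  change Finset (Ideal (biRees I J)) at t
  replace htp : ∀ T ∈ t, Ideal.IsPrimary T := fun T hT => (htp hT)
  have hle : ∀ T ∈ t, Q ≤ T := fun T hT => ht ▸ Finset.inf_le (f := id) hT
  have hc : ∀ T : Ideal (biRees I J), ∃ c,
      (degreeLeft I J 1 : Set (biRees I J)) ⊆ T.radical →
        Ideal.span (degreeLeft I J 1 : Set (biRees I J)) ^ c ≤ T := by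
    intro T
    by_cases h : (degreeLeft I J 1 : Set (biRees I J)) ⊆ T.radical
    · obtain ⟨c, hc⟩ := T.exists_radical_pow_le_of_fg (IsNoetherian.noetherian _)
      exact ⟨c, fun _ => (Ideal.pow_right_mono (Ideal.span_le.2 h) c).trans hc⟩
    · exact ⟨0, fun h' => absurd h' h⟩
  choose c hc using hc
  refine ⟨(t.filter fun T => ¬ (degreeLeft I J 1 : Set (biRees I J)) ⊆ T.radical).image
    Ideal.radical, t.sup c, ?_, ?_, ?_⟩
  · intro P hP
    obtain ⟨T, hT, rfl⟩ := Finset.mem_image.1 hP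
    exact Ideal.isPrime_radical (htp T (Finset.mem_filter.1 hT).1)
  · intro P hP
    obtain ⟨T, hT, rfl⟩ := Finset.mem_image.1 hP
    exact Set.not_subset.1 (Finset.mem_filter.1 hT).2
  · intro x hx m hm y hy hmem
    rw [← ht, Submodule.mem_finsetInf]
    intro (T : Ideal (biRees I J)) hT
    by_cases h : (degreeLeft I J 1 : Set (biRees I J)) ⊆ T.radical
    · exact hc T h (mon_mem_span_degreeLeft_pow _ ((Finset.le_sup hT).trans hm) hy)
    · have hx' := hx T.radical (Finset.mem_image_of_mem _ (Finset.mem_filter.2 ⟨hT, h⟩))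
      rw [mul_comm] at hmem
      exact ((Ideal.isPrimary_iff.1 (htp T hT)).2 (hle T hT hmem)).resolve_right hx'

end biRees

/-- An element `a ∈ I ^ k` is superficial of order `k` for the bigraded filtration given by `I` and
`J`, from left degree `c` on. -/
structure IsSuperficial (I J : Ideal R) (k c : ℕ) (a : R) : Prop where
  mem : a ∈ I ^ k
  left : ∀ r s, c ≤ r → ∀ y ∈ I ^ r * J ^ s, a * y ∈ I ^ (r + k + 1) * J ^ s →
    y ∈ I ^ (r + 1) * J ^ s
  right : ∀ r s, c ≤ r → ∀ y ∈ I ^ r * J ^ s, a * y ∈ I ^ (r + k) * J ^ (s + 1) →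
    y ∈ I ^ r * J ^ (s + 1)

/-- One element of bidegree (k,0) avoids the relevant primes of both extended ideals, of `I` and of
`J`; these give the conditions `left` and `right`. -/
theorem exists_isSuperficial [IsNoetherianRing R] (I J : Ideal R) :
    ∃ k₀ c, ∀ k ≥ k₀, ∃ a, IsSuperficial I J k c a := by
  classical
  obtain ⟨s₁, c₁, hp₁, hd₁, h₁⟩ :=
    biRees.exists_primes_forall_mem (I.map (algebraMap R (biRees I J)))
  obtain ⟨s₂, c₂, hp₂, hd₂, h₂⟩ :=
    biRees.exists_primes_forall_mem (J.map (algebraMap R (biRees I J)))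
  obtain ⟨k₀, hk⟩ := exists_mem_graded_notMem_of_isPrime (biRees.degreeLeft I J)
    biRees.one_mem_degreeLeft biRees.mul_mem_degreeLeft (s₁ ∪ s₂)
    (fun P hP => (Finset.mem_union.1 hP).elim (hp₁ P) (hp₂ P))
    (fun P hP => (Finset.mem_union.1 hP).elim (hd₁ P) (hd₂ P))
  refine ⟨k₀, max c₁ c₂, fun k hk' => ?_⟩
  obtain ⟨x, ⟨a, ha, hx⟩, hxP⟩ := hk k hk'
  have hmul : ∀ (r s : ℕ) (y : R) (hy : y ∈ I ^ r * J ^ s),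
      ∃ (m n : Fin 2 →₀ ℕ) (hy : y ∈ I ^ m 0 * J ^ m 1) (hay : a * y ∈ I ^ n 0 * J ^ n 1),
        m 0 = r ∧ m 1 = s ∧ n 0 = r + k ∧ n 1 = s ∧
        x * biRees.mon m y hy = biRees.mon n (a * y) hay := by
    intro r s y hy
    refine ⟨Finsupp.single 0 r + Finsupp.single 1 s,
      Finsupp.single 0 k + (Finsupp.single 0 r + Finsupp.single 1 s), by simpa using hy, ?_,
      by simp, by simp, by simp [add_comm], by simp, ?_⟩
    · have := Ideal.mul_mem_mul ha hy
      rw [← mul_assoc, ← pow_add] at this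
      simpa using this
    · apply Subtype.ext
      rw [Subalgebra.coe_mul, hx, biRees.mon, biRees.mon, monomial_mul]
  refine ⟨a, ha, ?_, ?_⟩
  · intro r s hr y hy hay
    obtain ⟨m, n, hy', hay', hm0, hm1, hn0, hn1, he⟩ := hmul r s y hy
    have := biRees.coeff_mem_of_mem_map (h₁ x (fun P hP => hxP P (Finset.mem_union_left _ hP)) m
      (hm0 ▸ le_of_max_le_left hr) y hy' (by
        rw [he]
        refine biRees.mon_mem_map _ ?_
        rw [hn0, hn1, mul_right_comm, ← pow_succ]
        exact hay)) m
    rw [biRees.mon, coeff_monomial, if_pos rfl, hm0, hm1, mul_right_comm, ← pow_succ] at this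
    exact this
  · intro r s hr y hy hay
    obtain ⟨m, n, hy', hay', hm0, hm1, hn0, hn1, he⟩ := hmul r s y hy
    have := biRees.coeff_mem_of_mem_map (h₂ x (fun P hP => hxP P (Finset.mem_union_right _ hP)) m
      (hm0 ▸ le_of_max_le_right hr) y hy' (by
        rw [he]
        refine biRees.mon_mem_map _ ?_
        rw [hn0, hn1, mul_assoc, ← pow_succ]
        exact hay)) m
    rw [biRees.mon, coeff_monomial, if_pos rfl, hm0, hm1, mul_assoc, ← pow_succ] at this
    exact this

end BiRees

/-! ### Quotients by superficial elements: dimension and length. -/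

open scoped Pointwise in
theorem ringKrullDim_quotient_span_eq {R : Type*} [CommRing R] [IsNoetherianRing R] [IsLocalRing R]
    {a : R} (ha : a ∈ IsLocalRing.maximalIdeal R) (hmin : ∀ P ∈ minimalPrimes R, a ∉ P) {d : ℕ}
    (hd : ringKrullDim R = (d + 1 : ℕ)) : ringKrullDim (R ⧸ Ideal.span {a}) = d := by
  have h1 := Module.supportDim_quotSMulTop_succ_eq_of_notMem_minimalPrimes_of_mem_maximalIdeal
    (R := R) (M := R) (x := a) ?_ ha
  · have h2 : Module.supportDim R (QuotSMulTop a R) = ringKrullDim (R ⧸ Ideal.span {a}) := by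
      rw [← Module.supportDim_quotient_eq_ringKrullDim]
      have h : Ideal.span {a} = a • (⊤ : Ideal R) := by
        simp [← Submodule.ideal_span_singleton_smul]
      rw [h]
    rw [Module.supportDim_self_eq_ringKrullDim, hd, h2] at h1
    generalize ringKrullDim (R ⧸ Ideal.span {a}) = x at h1
    induction x using WithBot.recBotCoe with
    | bot =>
      rw [WithBot.bot_add] at h1
      exact absurd h1 (WithBot.bot_ne_coe (a := ((d + 1 : ℕ) : ℕ∞)))
    | coe x =>
      have h3 : x + 1 = (d : ℕ∞) + 1 := by exact_mod_cast h1
      exact congrArg _ ((ENat.add_left_injective_of_ne_top (by simp)) h3)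
  · rwa [(Module.annihilator_eq_bot (R := R) (M := R)).2 inferInstance]

namespace IsSuperficial

variable {R : Type*} [CommRing R] {I J : Ideal R} {k c : ℕ} {a : R}

/-- The bound `c` does not grow with `m`. In dimension two this keeps the error term uniform in the
power. -/
theorem pow (h : IsSuperficial I J k c a) (m : ℕ) : IsSuperficial I J (k * m) c (a ^ m) := by
  have key : ∀ m r s, ∀ y ∈ I ^ r * J ^ s, a ^ m * y ∈ I ^ (r + k * m) * J ^ s := by
    intro m r s y hy
    have := Ideal.mul_mem_mul (Ideal.pow_mem_pow h.mem m) hy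
    rwa [← mul_assoc, ← pow_mul, ← pow_add, add_comm] at this
  refine ⟨pow_mul I k m ▸ Ideal.pow_mem_pow h.mem m, ?_, ?_⟩
  · intro r s hr y hy
    induction m with
    | zero => simp
    | succ m ih =>
      intro hay
      refine ih (h.left _ s (hr.trans (Nat.le_add_right _ _)) _ (key m r s y hy) ?_)
      rw [← mul_assoc, ← pow_succ']
      convert hay using 3
      ring
  · intro r s hr y hy
    induction m with
    | zero => simp
    | succ m ih =>
      intro hay
      refine ih (h.right _ s (hr.trans (Nat.le_add_right _ _)) _ (key m r s y hy) ?_)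
      rw [← mul_assoc, ← pow_succ']
      convert hay using 3
      ring

theorem mem_right (h : IsSuperficial I J k c a) {r : ℕ} (hr : c ≤ r) (s : ℕ) {y : R}
    (hy : y ∈ I ^ r) (hay : a * y ∈ I ^ (r + k) * J ^ s) : y ∈ I ^ r * J ^ s := by
  induction s with
  | zero => simpa using hy
  | succ s ih =>
    refine h.right r s hr y (ih ?_) hay
    exact Ideal.mul_mono_right (Ideal.pow_le_pow_right s.le_succ) hay

theorem mem_left (h : IsSuperficial I J k c a) {r : ℕ} (hr : c ≤ r) (s n : ℕ) {y : R}
    (hy : y ∈ I ^ r * J ^ s) (hay : a * y ∈ I ^ (r + n + k) * J ^ s) :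
    y ∈ I ^ (r + n) * J ^ s := by
  induction n with
  | zero => exact hy
  | succ n ih =>
    refine h.left (r + n) s (hr.trans (Nat.le_add_right _ _)) y (ih ?_) ?_
    · exact Ideal.mul_mono_left (Ideal.pow_le_pow_right (by omega)) hay
    · convert hay using 3
      ring

variable [IsNoetherianRing R] [IsLocalRing R]

/-- Superficiality pushes `y` into every power of `I`, so Krull's intersection theorem applies. -/
theorem eq_zero (h : IsSuperficial I J k c a) (hI : I ≠ ⊤) {y : R} (hy : y ∈ I ^ c)
    (hay : a * y = 0) : y = 0 := by
  rw [← Ideal.mem_bot, ← Ideal.iInf_pow_eq_bot_of_isLocalRing I hI, Ideal.mem_iInf]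
  intro n
  have := h.mem_left le_rfl 0 n (y := y) (by simpa using hy) (by simp [hay])
  rw [pow_zero, mul_one] at this
  exact Ideal.pow_le_pow_right (Nat.le_add_left _ _) this

/-- The prime is P = (0 : y) for some `y`. If a ∈ P, choose w ∈ I^c outside `P`: then wy ∈ I^c is
killed by `a`, so wy = 0 and w ∈ P. -/
theorem notMem_of_mem_minimalPrimes (h : IsSuperficial I J k c a) (hI : I ≠ ⊤) {P : Ideal R}
    (hP : P ∈ minimalPrimes R) (hIP : ¬ I ≤ P) : a ∉ P := by
  intro ha
  have := hP.1.1
  obtain ⟨y, rfl⟩ := Submodule.exists_eq_colon_of_mem_minimalPrimes (N := (⊥ : Ideal R)) (x := (1 : R))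
    (I := P) (by
      have : ((⊥ : Submodule R R).colon {(1 : R)} : Ideal R) = ⊥ := by
        ext
        simp [Submodule.mem_colon_singleton]
      rwa [this])
  obtain ⟨w, hw, hwP⟩ := SetLike.not_le_iff_exists.1
    (fun hle : I ^ c ≤ Submodule.colon ⊥ {y} => hIP (this.le_of_pow_le hle))
  simp only [Submodule.mem_colon_singleton, Submodule.mem_bot, smul_eq_mul] at ha hwP
  exact hwP (h.eq_zero hI (Ideal.mul_mem_right _ _ hw) (by
    rw [mul_left_comm, ha, mul_zero]))

theorem ringKrullDim_quotient (h : IsSuperficial I J k c a) (hI : IsCofinite I) (hk : k ≠ 0) {d : ℕ}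
    (hd : ringKrullDim R = (d + 1 : ℕ)) : ringKrullDim (R ⧸ Ideal.span {a}) = d := by
  have hI' : I ≠ ⊤ := fun h => IsLocalRing.maximalIdeal.isMaximal R |>.ne_top (top_le_iff.1 (h ▸ hI.1))
  have ham : a ∈ IsLocalRing.maximalIdeal R := hI.1 (Ideal.pow_le_self hk h.mem)
  refine ringKrullDim_quotient_span_eq ham (fun P hP => ?_) hd
  refine h.notMem_of_mem_minimalPrimes hI' hP fun hIP => ?_
  -- A minimal prime containing `I` contains the maximal ideal, which would force dimension zero.
  obtain ⟨n, hn⟩ := hI.2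
  have := hP.1.1
  have hle : IsLocalRing.maximalIdeal R ≤ P := this.le_of_pow_le (hn.trans hIP)
  have h0 : ringKrullDim R = 0 := by
    refine ringKrullDimZero_iff_ringKrullDim_eq_zero.1 (Ring.KrullDimLE.mk₀ fun Q hQ => ?_)
    have hQm := IsLocalRing.le_maximalIdeal hQ.ne_top
    rw [le_antisymm hQm (hle.trans (hP.2 ⟨hQ, bot_le⟩ (hQm.trans hle)))]
    infer_instance
  rw [h0] at hd
  exact absurd hd (by exact_mod_cast (Nat.succ_ne_zero d).symm)

/-- The annihilator of a superficial element has finite length. -/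
theorem length_colon_le (h : IsSuperficial I J k c a) (hI : I ≠ ⊤) :
    Module.length R ((⊥ : Ideal R).colon {a} : Ideal R) ≤ colength (I ^ c) := by
  refine length_le_colength_of_inf_eq_bot (eq_bot_iff.2 ?_)
  rintro y ⟨h1, h2⟩
  rw [SetLike.mem_coe, Submodule.mem_colon_singleton, Submodule.mem_bot, smul_eq_mul, mul_comm] at h1
  exact h.eq_zero hI h2 h1

/-- For large `r` the colon of I^(r+k)J^s by `a` is the direct sum of (0 : a) and I^rJ^s. The
threshold is uniform in `s`. -/
theorem exists_colength_add (h : IsSuperficial I J k c a) (hI : I ≠ ⊤) :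
    ∃ N, ∀ r ≥ N, ∀ s, colength (I ^ (r + k) * J ^ s) +
        Module.length R ((⊥ : Ideal R).colon {a} : Ideal R) =
      colength (I ^ r * J ^ s) + colength (Ideal.span {a} ⊔ I ^ (r + k) * J ^ s) := by
  -- Artin–Rees: if ay ∈ I^(r+k)J^s, then ay = aw with w ∈ I^(r-c₀). Superficiality moves `w` into
  -- I^rJ^s, and y - w is killed by `a`.
  obtain ⟨c₀, hc₀⟩ := I.exists_pow_inf_eq_pow_smul (M := R) (Ideal.span {a})
  refine ⟨c + c₀, fun r hr s => ?_⟩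
  have hcolon : (I ^ (r + k) * J ^ s).colon {a} = (⊥ : Ideal R).colon {a} ⊔ I ^ r * J ^ s := by
    ext y
    rw [Submodule.mem_colon_singleton, smul_eq_mul, mul_comm y]
    constructor
    · intro hay
      have hmem : a * y ∈ (I ^ (r + k) • ⊤ ⊓ Ideal.span {a} : Submodule R R) := by
        refine ⟨?_, Ideal.mem_span_singleton'.2 ⟨y, mul_comm _ _⟩⟩
        simpa using (Ideal.mul_le_left : I ^ (r + k) * J ^ s ≤ I ^ (r + k)) hay
      rw [hc₀ _ (by omega)] at hmem
      have hmem' : a * y ∈ I ^ (r + k - c₀) * Ideal.span {a} :=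
        Submodule.smul_mono le_rfl inf_le_right hmem
      rw [Ideal.mem_mul_span_singleton] at hmem'
      obtain ⟨w, hw, hwa⟩ := hmem'
      have hw1 : w ∈ I ^ (r - c₀) := Ideal.pow_le_pow_right (by omega) hw
      have hw2 := h.mem_right (by omega) s hw1 (by
        rw [mul_comm a, hwa]
        exact Ideal.mul_mono_left (Ideal.pow_le_pow_right (by omega)) hay)
      have hw3 := h.mem_left (by omega) s c₀ hw2 (by
        rw [mul_comm a, hwa, Nat.sub_add_cancel (by omega)]
        exact hay)
      rw [Nat.sub_add_cancel (by omega)] at hw3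
      rw [← sub_add_cancel y w]
      refine Ideal.add_mem _ (Ideal.mem_sup_left ?_) (Ideal.mem_sup_right hw3)
      rw [Submodule.mem_colon_singleton, Submodule.mem_bot, smul_eq_mul, sub_mul, hwa, mul_comm y,
        sub_self]
    · intro hy
      obtain ⟨z, hz, w, hw, rfl⟩ := Submodule.mem_sup.1 hy
      rw [Submodule.mem_colon_singleton, Submodule.mem_bot, smul_eq_mul, mul_comm] at hz
      rw [mul_add, hz, zero_add]
      have := Ideal.mul_mem_mul h.mem hw
      rwa [← mul_assoc, ← pow_add, add_comm] at this
  have hinf : (⊥ : Ideal R).colon {a} ⊓ I ^ r * J ^ s = ⊥ := by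
    refine eq_bot_iff.2 ?_
    rintro y ⟨h1, h2⟩
    rw [SetLike.mem_coe, Submodule.mem_colon_singleton, Submodule.mem_bot, smul_eq_mul,
      mul_comm] at h1
    have h3 : y ∈ I ^ r := (Ideal.mul_le_left : I ^ r * J ^ s ≤ I ^ r) h2
    exact h.eq_zero hI (Ideal.pow_le_pow_right (by omega) h3) h1
  rw [colength_eq_colon_add _ a, hcolon, colength_eq_add_length_of_inf_eq_bot hinf]
  abel

end IsSuperficial

/-! ### Numerical polynomials in one and two variables, in the binomial basis. -/

section BinomialSum

open Finset

/-- The univariate numerical polynomial with binomial coefficients `x`. -/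
def binomialSum₁ (D : ℕ) (x : ℕ → ℚ) (r : ℕ) : ℚ := ∑ a ∈ range (D + 1), x a * r.choose a

/-- The bivariate numerical polynomial with binomial coefficients `c`. -/
def binomialSum (D : ℕ) (c : ℕ → ℕ → ℚ) (r s : ℕ) : ℚ :=
  ∑ a ∈ range (D + 1), ∑ b ∈ range (D + 1), c a b * r.choose a * s.choose b

theorem binomialSum_eq_left (D : ℕ) (c : ℕ → ℕ → ℚ) (r s : ℕ) :
    binomialSum D c r s = binomialSum₁ D (fun a => binomialSum₁ D (c a) s) r := by
  simp only [binomialSum, binomialSum₁, sum_mul]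
  refine sum_congr rfl fun a _ => sum_congr rfl fun b _ => by ring

theorem binomialSum_swap (D : ℕ) (c : ℕ → ℕ → ℚ) (r s : ℕ) :
    binomialSum D (fun a b => c b a) s r = binomialSum D c r s := by
  rw [binomialSum, sum_comm]
  refine sum_congr rfl fun a _ => sum_congr rfl fun b _ => by ring

theorem binomialSum_eq_right (D : ℕ) (c : ℕ → ℕ → ℚ) (r s : ℕ) :
    binomialSum D c r s = binomialSum₁ D (fun b => binomialSum₁ D (fun a => c a b) r) s := by
  rw [← binomialSum_swap, binomialSum_eq_left]

theorem binomialSum₁_add (D : ℕ) (x y : ℕ → ℚ) (r : ℕ) :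
    binomialSum₁ D (fun a => x a + y a) r = binomialSum₁ D x r + binomialSum₁ D y r := by
  simp [binomialSum₁, add_mul, sum_add_distrib]

theorem binomialSum₁_sub (D : ℕ) (x y : ℕ → ℚ) (r : ℕ) :
    binomialSum₁ D (fun a => x a - y a) r = binomialSum₁ D x r - binomialSum₁ D y r := by
  simp [binomialSum₁, sub_mul]

theorem binomialSum_add (D : ℕ) (c e : ℕ → ℕ → ℚ) (r s : ℕ) :
    binomialSum D (fun a b => c a b + e a b) r s = binomialSum D c r s + binomialSum D e r s := by
  simp only [binomialSum_eq_left, binomialSum₁_add]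

theorem binomialSum_sub (D : ℕ) (c e : ℕ → ℕ → ℚ) (r s : ℕ) :
    binomialSum D (fun a b => c a b - e a b) r s = binomialSum D c r s - binomialSum D e r s := by
  simp only [binomialSum_eq_left, binomialSum₁_sub]

theorem binomialSum₁_eq_add_zero (D : ℕ) (x : ℕ → ℚ) (r : ℕ) :
    binomialSum₁ (D + 1) x r = ∑ a ∈ range (D + 1), x (a + 1) * r.choose (a + 1) + x 0 := by
  rw [binomialSum₁, sum_range_succ' _ (D + 1)]
  simp

theorem binomialSum₁_succ' (D : ℕ) (x : ℕ → ℚ) (r : ℕ) :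
    binomialSum₁ (D + 1) x (r + 1) =
      binomialSum₁ (D + 1) x r + binomialSum₁ D (fun a => x (a + 1)) r := by
  rw [binomialSum₁_eq_add_zero, binomialSum₁_eq_add_zero, binomialSum₁]
  simp only [Nat.choose_succ_succ, Nat.cast_add, mul_add, sum_add_distrib]
  ring

theorem binomialSum₁_succ (D : ℕ) (x : ℕ → ℚ) (hx : x (D + 1) = 0) (r : ℕ) :
    binomialSum₁ D x (r + 1) = binomialSum₁ D x r + binomialSum₁ D (fun a => x (a + 1)) r := by
  have h1 : ∀ n, binomialSum₁ D x n = binomialSum₁ (D + 1) x n := by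
    intro n
    rw [binomialSum₁, binomialSum₁, sum_range_succ _ (D + 1), hx, zero_mul, add_zero]
  rw [h1, h1, binomialSum₁_succ']

theorem binomialSum₁_eq_zero {D : ℕ} {x : ℕ → ℚ} {N : ℕ} (h : ∀ r ≥ N, binomialSum₁ D x r = 0) :
    ∀ a ≤ D, x a = 0 := by
  induction D generalizing x with
  | zero =>
    intro a ha
    obtain rfl : a = 0 := by omega
    simpa [binomialSum₁] using h N le_rfl
  | succ D ih =>
    have hs : ∀ r ≥ N, binomialSum₁ D (fun a => x (a + 1)) r = 0 := by
      intro r hr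
      have := binomialSum₁_succ' D x r
      rw [h r hr, h (r + 1) (by omega), zero_add] at this
      exact this.symm
    have h0 := ih hs
    have h00 : x 0 = 0 := by
      have := h N le_rfl
      rw [binomialSum₁_eq_add_zero, sum_eq_zero] at this
      · simpa using this
      · intro a ha
        rw [h0 a (by simpa [Nat.lt_succ_iff] using ha), zero_mul]
    intro a ha
    cases a with
    | zero => exact h00
    | succ a => exact h0 a (by omega)

theorem binomialSum_eq_zero {D : ℕ} {c : ℕ → ℕ → ℚ} {N : ℕ}
    (h : ∀ r ≥ N, ∀ s ≥ N, binomialSum D c r s = 0) : ∀ a ≤ D, ∀ b ≤ D, c a b = 0 := by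
  intro a ha
  refine binomialSum₁_eq_zero (N := N) fun s hs => ?_
  refine binomialSum₁_eq_zero (x := fun a => binomialSum₁ D (c a) s) (N := N) (fun r hr => ?_) a ha
  rw [← binomialSum_eq_left, h r hr s hs]

/-- The binomial coefficients of a bivariate polynomial of total degree at most `d`. -/
def DegreeLE (d : ℕ) (c : ℕ → ℕ → ℚ) : Prop := ∀ a b, d < a + b → c a b = 0

theorem binomialSum_succ_left {D : ℕ} {c : ℕ → ℕ → ℚ} (hc : DegreeLE D c) (r s : ℕ) :
    binomialSum D c (r + 1) s =
      binomialSum D c r s + binomialSum D (fun a b => c (a + 1) b) r s := by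
  simp only [binomialSum_eq_left]
  rw [binomialSum₁_succ]
  refine sum_eq_zero fun b _ => ?_
  rw [hc _ _ (by omega), zero_mul]

theorem binomialSum_succ_right {D : ℕ} {c : ℕ → ℕ → ℚ} (hc : DegreeLE D c) (r s : ℕ) :
    binomialSum D c r (s + 1) =
      binomialSum D c r s + binomialSum D (fun a b => c a (b + 1)) r s := by
  simp only [← binomialSum_swap D _ r]
  exact binomialSum_succ_left (fun a b h => hc b a (by omega)) s r

theorem binomialSum_eq_of_le {d D : ℕ} (hd : d ≤ D) {c : ℕ → ℕ → ℚ} (hc : DegreeLE d c) (r s : ℕ) :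
    binomialSum D c r s = binomialSum d c r s := by
  have h1 : ∀ a s, binomialSum₁ D (c a) s = binomialSum₁ d (c a) s := by
    intro a s
    refine (sum_subset (range_mono (by omega)) fun b _ hb => ?_).symm
    rw [mem_range, not_lt] at hb
    rw [hc _ _ (by omega), zero_mul]
  rw [binomialSum_eq_left, binomialSum_eq_left]
  simp only [h1]
  refine (sum_subset (range_mono (by omega)) fun b _ hb => ?_).symm
  rw [mem_range, not_lt] at hb
  refine mul_eq_zero_of_left (sum_eq_zero fun a _ => ?_) _
  rw [hc _ _ (by omega), zero_mul]

/-- A translate of a numerical polynomial, together with its top coefficients. -/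
theorem exists_binomialSum_add_left {D : ℕ} {c : ℕ → ℕ → ℚ} (hc : DegreeLE D c) (k : ℕ) :
    ∃ e, DegreeLE D e ∧ (∀ r s, binomialSum D c (r + k) s = binomialSum D e r s) ∧
      (∀ a b, a + b = D → e a b = c a b) ∧
      (∀ a b, a + b + 1 = D → e a b = c a b + k * c (a + 1) b) := by
  induction k with
  | zero => exact ⟨c, hc, fun _ _ => rfl, fun _ _ _ => rfl, fun _ _ _ => by simp⟩
  | succ k ih =>
    obtain ⟨e, he, h1, h2, h3⟩ := ih
    refine ⟨fun a b => e a b + e (a + 1) b, fun a b h => ?_, fun r s => ?_, fun a b h => ?_,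
      fun a b h => ?_⟩
    · simp only [he a b h, he (a + 1) b (by omega), add_zero]
    · rw [show r + (k + 1) = r + 1 + k by ring, h1, binomialSum_succ_left he, binomialSum_add]
    · simp only [he (a + 1) b (by omega), h2 a b h, add_zero]
    · simp only [h3 a b h, h2 (a + 1) b (by omega)]
      push_cast
      ring

theorem exists_binomialSum₁_of_sub {D N : ℕ} {g y : ℕ → ℚ}
    (h : ∀ s ≥ N, g (s + 1) - g s = binomialSum₁ D y s) :
    ∃ x : ℕ → ℚ, (∀ b, x (b + 1) = y b) ∧ ∀ s ≥ N, g s = binomialSum₁ (D + 1) x s := by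
  let x₀ : ℕ → ℚ := fun b => Nat.casesOn b 0 y
  let x : ℕ → ℚ := fun b => Nat.casesOn b (g N - binomialSum₁ (D + 1) x₀ N) y
  have hx : ∀ s, binomialSum₁ (D + 1) x s = binomialSum₁ (D + 1) x₀ s + x 0 := by
    intro s
    rw [binomialSum₁_eq_add_zero, binomialSum₁_eq_add_zero, add_assoc]
    simp [x, x₀]
  have hstep : ∀ s, binomialSum₁ (D + 1) x (s + 1) =
      binomialSum₁ (D + 1) x s + binomialSum₁ D y s := binomialSum₁_succ' D x
  refine ⟨x, fun b => rfl, fun s hs => ?_⟩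
  induction s, hs using Nat.le_induction with
  | base => rw [hx]; simp [x]
  | succ s hs ih => rw [hstep, ← ih, ← h s hs]; ring

/-- Summation shifts the coefficients by one; the new constant term is fixed by the value at `N`. -/
theorem exists_binomialSum_of_sub {d N : ℕ} {f : ℕ → ℕ → ℚ} {p q : ℕ → ℕ → ℚ} (hp : DegreeLE d p)
    (hq : DegreeLE d q)
    (hfp : ∀ r ≥ N, ∀ s ≥ N, f (r + 1) s - f r s = binomialSum d p r s)
    (hfq : ∀ r ≥ N, ∀ s ≥ N, f r (s + 1) - f r s = binomialSum d q r s) :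
    ∃ c, DegreeLE (d + 1) c ∧ ∀ r ≥ N, ∀ s ≥ N, f r s = binomialSum (d + 1) c r s := by
  let c₀ : ℕ → ℕ → ℚ := fun a b => Nat.casesOn a 0 fun a => p a b
  have hc₀ : DegreeLE (d + 1) c₀ := by
    intro a b h
    cases a with
    | zero => rfl
    | succ a => exact hp a b (by omega)
  -- After subtraction of a sum of `p` in the first variable, the remainder depends on `s` alone,
  -- and `q` controls its difference.
  let g : ℕ → ℚ := fun s => f N s - binomialSum (d + 1) c₀ N s
  have hg : ∀ r ≥ N, ∀ s ≥ N, f r s = binomialSum (d + 1) c₀ r s + g s := by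
    intro r hr s hs
    induction r, hr using Nat.le_induction with
    | base => simp [g]
    | succ r hr ih =>
      have := hfp r hr s hs
      rw [binomialSum_succ_left hc₀, ← sub_eq_iff_eq_add'.2 ih, sub_eq_iff_eq_add.1 this,
        show (fun a b => c₀ (a + 1) b) = p from rfl, binomialSum_eq_of_le d.le_succ hp]
      ring
  let y : ℕ → ℚ := fun b => binomialSum₁ (d + 1) (fun a => q a b - c₀ a (b + 1)) N
  have hy : ∀ s ≥ N, g (s + 1) - g s = binomialSum₁ d y s := by
    intro s hs
    have h1 : g (s + 1) - g s =
        binomialSum (d + 1) (fun a b => q a b - c₀ a (b + 1)) N s := by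
      rw [binomialSum_sub, binomialSum_eq_of_le d.le_succ hq, ← hfq N le_rfl s hs]
      simp only [g, binomialSum_succ_right hc₀]
      ring
    rw [h1, binomialSum_eq_right]
    refine (sum_subset (range_mono (by omega)) fun b _ hb => ?_).symm
    rw [mem_range, not_lt] at hb
    refine mul_eq_zero_of_left (sum_eq_zero fun a _ => ?_) _
    beta_reduce
    rw [hq _ _ (by omega), hc₀ _ _ (by omega), sub_zero, zero_mul]
  obtain ⟨x, hx, hxg⟩ := exists_binomialSum₁_of_sub hy
  -- Truncation does not affect the values and ensures the degree bound on the coefficients.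
  let x' : ℕ → ℚ := fun b => if b ≤ d + 1 then x b else 0
  have hx' : ∀ s, binomialSum₁ (d + 1) x' s = binomialSum₁ (d + 1) x s := by
    intro s
    refine sum_congr rfl fun b hb => ?_
    rw [mem_range] at hb
    simp only [x', if_pos (show b ≤ d + 1 by omega)]
  let c : ℕ → ℕ → ℚ := fun a b => Nat.casesOn a (x' b) fun a => p a b
  refine ⟨c, ?_, fun r hr s hs => ?_⟩
  · intro a b h
    cases a with
    | zero => exact if_neg (by omega)
    | succ a => exact hp a b (by omega)
  · rw [hg r hr s hs, hxg s hs, ← hx', binomialSum_eq_left, binomialSum_eq_left _ c,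
      binomialSum₁_eq_add_zero d _ r, binomialSum₁_eq_add_zero d (fun a => _) r, add_assoc]
    congr 1
    simp [c₀, c, binomialSum₁]

end BinomialSum

/-! ### Polynomiality and positivity, by induction on the dimension. -/

section Main

open IsLocalRing

/-- The function `(r, s) ↦ ℓ(R / I ^ r J ^ s)`. -/
noncomputable def lengthFun {R : Type u} [CommRing R] (I J : Ideal R) (r s : ℕ) : ℕ :=
  (colength (I ^ r * J ^ s)).toNat

theorem lengthFun_swap {R : Type u} [CommRing R] (I J : Ideal R) (r s : ℕ) :
    lengthFun I J r s = lengthFun J I s r := by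
  rw [lengthFun, lengthFun, mul_comm]

/-- The function `(r, s) ↦ ℓ(R / I ^ r J ^ s)` eventually agrees with the numerical polynomial of
degree at most `d` with binomial coefficients `c`. -/
def HasBinomialCoeffs {R : Type u} [CommRing R] (d : ℕ) (I J : Ideal R) (c : ℕ → ℕ → ℚ) : Prop :=
  DegreeLE d c ∧ ∃ N, ∀ r ≥ N, ∀ s ≥ N, (lengthFun I J r s : ℚ) = binomialSum d c r s

theorem HasBinomialCoeffs.swap {R : Type u} [CommRing R] {d : ℕ} {I J : Ideal R} {c : ℕ → ℕ → ℚ}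
    (h : HasBinomialCoeffs d I J c) : HasBinomialCoeffs d J I fun a b => c b a := by
  obtain ⟨h1, N, h2⟩ := h
  refine ⟨fun a b hab => h1 b a (by omega), N, fun r hr s hs => ?_⟩
  rw [lengthFun_swap, binomialSum_swap, h2 s hs r hr]

theorem isLocalRing_quotient {R : Type u} [CommRing R] [IsLocalRing R] {A : Ideal R}
    (hA : A ≤ maximalIdeal R) : IsLocalRing (R ⧸ A) :=
  have : Nontrivial (R ⧸ A) := Ideal.Quotient.nontrivial_iff.2
    (fun h => (maximalIdeal.isMaximal R).ne_top (top_le_iff.1 (h ▸ hA)))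
  IsLocalRing.of_surjective' (Ideal.Quotient.mk A) Ideal.Quotient.mk_surjective

theorem IsCofinite.ne_top {R : Type u} [CommRing R] [IsLocalRing R] {I : Ideal R}
    (h : IsCofinite I) : I ≠ ⊤ := fun h' =>
  (maximalIdeal.isMaximal R).ne_top (top_le_iff.1 (h' ▸ h.1))

theorem IsSuperficial.le_maximalIdeal {R : Type u} [CommRing R] [IsLocalRing R] {I J : Ideal R}
    {k c : ℕ} {a : R} (h : IsSuperficial I J k c a)
    (hI : IsCofinite I) (hk : k ≠ 0) : Ideal.span {a} ≤ maximalIdeal R :=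
  (Ideal.span_singleton_le_iff_mem _).2 (hI.1 (Ideal.pow_le_self hk h.mem))

theorem colength_map_span {R : Type u} [CommRing R] {I J : Ideal R} {a : R} (r s : ℕ) :
    colength (I.map (Ideal.Quotient.mk (Ideal.span {a})) ^ r *
      J.map (Ideal.Quotient.mk (Ideal.span {a})) ^ s) =
    colength (Ideal.span {a} ⊔ I ^ r * J ^ s) := by
  rw [← Ideal.map_pow, ← Ideal.map_pow, ← Ideal.map_mul, colength_map_quotient]

variable {R : Type u} [CommRing R] [IsLocalRing R] [IsNoetherianRing R] {I J : Ideal R}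

theorem coe_lengthFun (hI : IsCofinite I) (hJ : IsCofinite J) (r s : ℕ) :
    (lengthFun I J r s : ℕ∞) = colength (I ^ r * J ^ s) :=
  ENat.natCast_toNat (hI.colength_ne_top hJ r s)

theorem ringKrullDim_eq_zero_iff_maximalIdeal_pow :
    ringKrullDim R = 0 ↔ ∃ n, maximalIdeal R ^ n = ⊥ := by
  rw [← ringKrullDimZero_iff_ringKrullDim_eq_zero, ← isArtinianRing_iff_krullDimLE_zero,
    isArtinianRing_iff_isNilpotent_maximalIdeal]
  rfl

/-- The basic recursion: passing to the quotient by a superficial element takes differences. -/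
theorem IsSuperficial.exists_lengthFun_add {k c : ℕ} {a : R} (h : IsSuperficial I J k c a)
    (hI : IsCofinite I) (hJ : IsCofinite J) :
    ∃ N, ∃ g : ℕ, (g : ℕ∞) ≤ colength (I ^ c) ∧ ∀ r ≥ N, ∀ s, lengthFun I J (r + k) s + g =
      lengthFun I J r s + lengthFun (I.map (Ideal.Quotient.mk (Ideal.span {a})))
        (J.map (Ideal.Quotient.mk (Ideal.span {a}))) (r + k) s := by
  obtain ⟨N, hN⟩ := h.exists_colength_add hI.ne_top
  have hg := h.length_colon_le hI.ne_top
  have hc : colength (I ^ c) ≠ ⊤ := by simpa using hI.colength_ne_top hJ c 0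
  obtain ⟨g, hg'⟩ := ENat.ne_top_iff_exists.1 (ne_top_of_le_ne_top hc hg)
  refine ⟨N, g, hg' ▸ hg, fun r hr s => ?_⟩
  have h1 := hN r hr s
  have h2 : colength (Ideal.span {a} ⊔ I ^ (r + k) * J ^ s) ≠ ⊤ :=
    ne_top_of_le_ne_top (hI.colength_ne_top hJ (r + k) s) (colength_anti le_sup_right)
  rw [← hg', ← coe_lengthFun hI hJ, ← coe_lengthFun hI hJ, ← ENat.natCast_toNat h2] at h1
  rw [lengthFun, lengthFun, lengthFun, colength_map_span]
  exact_mod_cast h1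

theorem degreeLE_const (d : ℕ) (x : ℚ) : DegreeLE d (fun a b => if a = 0 ∧ b = 0 then x else 0) :=
  fun a b h => if_neg (by omega)

theorem DegreeLE.sub {d : ℕ} {c e : ℕ → ℕ → ℚ} (hc : DegreeLE d c) (he : DegreeLE d e) :
    DegreeLE d (fun a b => c a b - e a b) := fun a b h => by
  simp only [hc a b h, he a b h, sub_zero]

theorem binomialSum_const (D : ℕ) (x : ℚ) (r s : ℕ) :
    binomialSum D (fun a b => if a = 0 ∧ b = 0 then x else 0) r s = x := by
  rw [binomialSum_eq_of_le (Nat.zero_le D) (d := 0)]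
  · simp [binomialSum]
  · exact degreeLE_const 0 x

theorem exists_lengthFun_succ_sub {d : ℕ} (hd : ringKrullDim R = (d + 1 : ℕ))
    (hI : IsCofinite I) (hJ : IsCofinite J)
    (ih : ∀ (A : Ideal R) [IsLocalRing (R ⧸ A)], ringKrullDim (R ⧸ A) = d →
      ∃ p, HasBinomialCoeffs d (I.map (Ideal.Quotient.mk A)) (J.map (Ideal.Quotient.mk A)) p) :
    ∃ p, DegreeLE d p ∧ ∃ N, ∀ r ≥ N, ∀ s ≥ N,
      (lengthFun I J (r + 1) s : ℚ) - lengthFun I J r s = binomialSum d p r s := by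
  obtain ⟨k₀, c, hk₀⟩ := exists_isSuperficial I J
  have key : ∀ k, k ≠ 0 → k₀ ≤ k → ∃ p, DegreeLE d p ∧ ∃ N, ∀ r ≥ N, ∀ s ≥ N,
      (lengthFun I J (r + k) s : ℚ) - lengthFun I J r s = binomialSum d p (r + k) s := by
    intro k hk hk'
    obtain ⟨a, ha⟩ := hk₀ k hk'
    have := isLocalRing_quotient (ha.le_maximalIdeal hI hk)
    obtain ⟨p, hp, N₁, hN₁⟩ := ih _ (ha.ringKrullDim_quotient hI hk hd)
    obtain ⟨N₂, g, -, hN₂⟩ := ha.exists_lengthFun_add hI hJ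
    refine ⟨_, hp.sub (degreeLE_const d (g : ℚ)), max N₁ N₂, fun r hr s hs => ?_⟩
    · have h1 := hN₁ (r + k) ((le_of_max_le_left hr).trans (Nat.le_add_right _ _)) s
        (le_of_max_le_left hs)
      have h2 := congrArg (Nat.cast : ℕ → ℚ) (hN₂ r (le_of_max_le_right hr) s)
      rw [binomialSum_sub, binomialSum_const, ← h1]
      push_cast at h2
      linarith
  -- Superficial elements control only differences of large step; two consecutive steps subtract to
  -- a difference of step one.
  obtain ⟨p, hp, N₁, hN₁⟩ := key (k₀ + 1) (by omega) (by omega)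
  obtain ⟨q, hq, N₂, hN₂⟩ := key (k₀ + 2) (by omega) (by omega)
  obtain ⟨e, he, he', -⟩ := exists_binomialSum_add_left hq 1
  refine ⟨_, he.sub hp, max N₁ N₂ + (k₀ + 1), fun r hr s hs => ?_⟩
  · obtain ⟨r, rfl⟩ := Nat.exists_eq_add_of_le' ((Nat.le_add_left _ _).trans hr)
    have h1 := hN₁ r (by omega) s (by omega)
    have h2 := hN₂ r (by omega) s (by omega)
    rw [binomialSum_sub, ← he', ← h1, add_assoc r, ← h2]
    ring

theorem exists_hasBinomialCoeffs (d : ℕ) : ∀ {R : Type u} [CommRing R] [IsLocalRing R]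
    [IsNoetherianRing R], ringKrullDim R = d → ∀ {I J : Ideal R}, IsCofinite I → IsCofinite J →
      ∃ c, HasBinomialCoeffs d I J c := by
  induction d with
  | zero =>
    intro R _ _ _ hd I J hI hJ
    obtain ⟨n, hn⟩ := ringKrullDim_eq_zero_iff_maximalIdeal_pow.1 hd
    refine ⟨_, degreeLE_const 0 ((colength (⊥ : Ideal R)).toNat : ℚ), n, fun r hr s _ => ?_⟩
    have : I ^ r = ⊥ := eq_bot_iff.2 (hn ▸ (Ideal.pow_right_mono hI.1 r).trans
      (Ideal.pow_le_pow_right hr))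
    rw [binomialSum_const, lengthFun, this, Ideal.bot_mul]
  | succ d ih =>
    intro R _ _ _ hd I J hI hJ
    obtain ⟨p, hp, N₁, hN₁⟩ := exists_lengthFun_succ_sub hd hI hJ
      (fun A _ hA => ih hA (hI.map_quotient A) (hJ.map_quotient A))
    obtain ⟨q, hq, N₂, hN₂⟩ := exists_lengthFun_succ_sub hd hJ hI
      (fun A _ hA => ih hA (hJ.map_quotient A) (hI.map_quotient A))
    obtain ⟨c, hc, hN⟩ := exists_binomialSum_of_sub (N := max N₁ N₂)
      (f := fun r s => (lengthFun I J r s : ℚ)) hp (q := fun a b => q b a)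
      (fun a b h => hq b a (by omega))
      (fun r hr s hs => hN₁ r (le_of_max_le_left hr) s (le_of_max_le_left hs))
      (fun r hr s hs => by
        rw [binomialSum_swap d q s r, ← hN₂ s (le_of_max_le_right hs) r (le_of_max_le_right hr),
          lengthFun_swap, lengthFun_swap I])
    exact ⟨c, hc, _, hN⟩

/-- Compare coefficients of degree `d` in the recursion. The constant ℓ(0 : a) has degree zero, so
it does not interfere when `d ≠ 0`. -/
theorem HasBinomialCoeffs.eq_mul_of_isSuperficial {d : ℕ} (hd : d ≠ 0) {c p : ℕ → ℕ → ℚ}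
    (h : HasBinomialCoeffs (d + 1) I J c) {k c₀ : ℕ} {a : R} (ha : IsSuperficial I J k c₀ a)
    (hI : IsCofinite I) (hJ : IsCofinite J)
    (hp : HasBinomialCoeffs d (I.map (Ideal.Quotient.mk (Ideal.span {a})))
      (J.map (Ideal.Quotient.mk (Ideal.span {a}))) p) {x y : ℕ} (hxy : x + y = d) :
    p x y = k * c (x + 1) y := by
  obtain ⟨hc, N₁, hN₁⟩ := h
  obtain ⟨hp, N₂, hN₂⟩ := hp
  obtain ⟨N₃, g, -, hN₃⟩ := ha.exists_lengthFun_add hI hJ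
  obtain ⟨e, -, he1, -, he3⟩ := exists_binomialSum_add_left hc k
  obtain ⟨e', he', he1', he2', -⟩ := exists_binomialSum_add_left hp k
  have hz : ∀ r ≥ N₁ + N₂ + N₃, ∀ s ≥ N₁ + N₂ + N₃, binomialSum (d + 1) (fun a b =>
      (e a b - c a b) - (e' a b - if a = 0 ∧ b = 0 then (g : ℚ) else 0)) r s = 0 := by
    intro r hr s hs
    have h1 := hN₁ (r + k) (by omega) s (by omega)
    have h2 := hN₁ r (by omega) s (by omega)
    have h3 := hN₂ (r + k) (by omega) s (by omega)
    have h4 := congrArg (Nat.cast : ℕ → ℚ) (hN₃ r (by omega) s)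
    push_cast at h4
    rw [binomialSum_sub, binomialSum_sub, binomialSum_sub, binomialSum_const, ← he1,
      binomialSum_eq_of_le d.le_succ he', ← he1', ← h1, ← h2, ← h3]
    linarith
  have := binomialSum_eq_zero hz x (by omega) y (by omega)
  rw [he3 x y (by omega), he2' x y hxy, if_neg (by omega)] at this
  linarith

/-- Equality would give I·I^rJ^s = I^rJ^s, hence I^rJ^s = 0 by Nakayama, and the maximal ideal would
be nilpotent. -/
theorem lengthFun_lt_succ (hdim : ringKrullDim R ≠ 0) (hI : IsCofinite I) (hJ : IsCofinite J)
    (r s : ℕ) : lengthFun I J r s < lengthFun I J (r + 1) s := by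
  have hle : I ^ (r + 1) * J ^ s ≤ I ^ r * J ^ s :=
    Ideal.mul_mono_left (Ideal.pow_le_pow_right r.le_succ)
  have h1 : colength (I ^ r * J ^ s) ≤ colength (I ^ (r + 1) * J ^ s) := colength_anti hle
  rw [← coe_lengthFun hI hJ, ← coe_lengthFun hI hJ, Nat.cast_le] at h1
  refine lt_of_le_of_ne h1 fun he => hdim ?_
  have h2 := eq_of_colength_eq hle (hI.colength_ne_top hJ _ _) (by
    rw [← coe_lengthFun hI hJ, ← coe_lengthFun hI hJ, he])
  have h3 : I ^ r * J ^ s = ⊥ := by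
    refine Submodule.eq_bot_of_le_smul_of_le_jacobson_bot I _ (IsNoetherian.noetherian _) ?_
      (hI.1.trans (maximalIdeal_le_jacobson _))
    rw [smul_eq_mul, ← mul_assoc, ← pow_succ', h2]
  obtain ⟨n, hn⟩ := hI.exists_pow_le_pow_mul_pow hJ r s
  exact ringKrullDim_eq_zero_iff_maximalIdeal_pow.2 ⟨n, eq_bot_iff.2 (h3 ▸ hn)⟩

/-- The recursion is useless here because ℓ(0 : a) enters the top coefficient. Instead, the
coefficient is the difference of two consecutive lengths. -/
theorem HasBinomialCoeffs.pos_of_dim_one {c : ℕ → ℕ → ℚ}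
    (h : HasBinomialCoeffs 1 I J c) (hdim : ringKrullDim R ≠ 0)
    (hI : IsCofinite I) (hJ : IsCofinite J) : 0 < c 1 0 := by
  obtain ⟨hc, N, hN⟩ := h
  have h1 := hN N le_rfl N le_rfl
  have h2 := hN (N + 1) N.le_succ N le_rfl
  have h3 : (lengthFun I J N N : ℚ) < lengthFun I J (N + 1) N :=
    Nat.cast_lt.2 (lengthFun_lt_succ hdim hI hJ N N)
  rw [h1, h2, binomialSum_succ_left hc] at h3
  have h4 : binomialSum 1 (fun a b => c (a + 1) b) N N = c 1 0 := by
    simp [binomialSum, Finset.sum_range_succ, hc 1 1 (by norm_num), hc 2 0 (by norm_num),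
      hc 2 1 (by norm_num)]
  linarith

theorem hasBinomialCoeffs_pos (d : ℕ) : ∀ {R : Type u} [CommRing R] [IsLocalRing R]
    [IsNoetherianRing R], ringKrullDim R = d → ∀ {I J : Ideal R}, IsCofinite I → IsCofinite J →
      ∀ {c}, HasBinomialCoeffs d I J c → ∀ x y, x + y = d → 0 < c x y := by
  induction d with
  | zero =>
    rintro R _ _ _ hd I J hI hJ c ⟨hc, N, hN⟩ x y hxy
    obtain ⟨rfl, rfl⟩ : x = 0 ∧ y = 0 := by omega
    have h1 := hN (N + 1) (by omega) N le_rfl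
    have h2 : 0 < lengthFun I J (N + 1) N := by
      rw [Nat.pos_iff_ne_zero]
      intro h0
      have := coe_lengthFun hI hJ (N + 1) N
      rw [h0, Nat.cast_zero, eq_comm, colength, Module.length_eq_zero_iff,
        Submodule.Quotient.subsingleton_iff] at this
      exact hI.ne_top (top_le_iff.1 (this ▸ Ideal.mul_le_left.trans (Ideal.pow_le_self (by omega))))
    have h3 : (0 : ℚ) < lengthFun I J (N + 1) N := Nat.cast_pos.2 h2
    simpa [h1, binomialSum] using h3
  | succ d ih =>
    intro R _ _ _ hd I J hI hJ c h x y hxy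
    have hd0 : ringKrullDim R ≠ 0 := by
      rw [hd]
      exact_mod_cast d.succ_ne_zero
    have key : ∀ {I J : Ideal R}, IsCofinite I → IsCofinite J → ∀ {c},
        HasBinomialCoeffs (d + 1) I J c → ∀ x y, x + y = d → 0 < c (x + 1) y := by
      intro I J hI hJ c h x y hxy
      by_cases hd1 : d = 0
      · subst hd1
        obtain ⟨rfl, rfl⟩ : x = 0 ∧ y = 0 := by omega
        exact h.pos_of_dim_one hd0 hI hJ
      · obtain ⟨k₀, c₀, hk⟩ := exists_isSuperficial I J
        obtain ⟨a, ha⟩ := hk (k₀ + 1) (by omega)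
        have := isLocalRing_quotient (ha.le_maximalIdeal hI (by omega))
        have hdq := ha.ringKrullDim_quotient hI (by omega) hd
        obtain ⟨p, hp⟩ := exists_hasBinomialCoeffs d hdq (hI.map_quotient _) (hJ.map_quotient _)
        have h1 := ih hdq (hI.map_quotient _) (hJ.map_quotient _) hp x y hxy
        rw [h.eq_mul_of_isSuperficial hd1 ha hI hJ hp hxy] at h1
        exact pos_of_mul_pos_right h1 (by positivity)
    -- The quotient by an element of a power of `I` sees only coefficients with positive first
    -- index; for index zero, exchange `I` and `J`.
    cases x with
    | succ x => exact key hI hJ h x y (by omega)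
    | zero =>
      obtain ⟨y, rfl⟩ : ∃ z, y = z + 1 := ⟨d, by omega⟩
      exact key hJ hI h.swap y 0 (by omega)

end Main

/-! ### Leading forms as limits along rays. -/

section Limits

open Finset Filter Topology

theorem tendsto_choose_div_pow (u w a : ℕ) :
    Tendsto (fun n : ℕ => ((u * n + w).choose a : ℝ) / (n : ℝ) ^ a) atTop
      (𝓝 ((u : ℝ) ^ a / (a ! : ℝ))) := by
  induction a with
  | zero => simp
  | succ a ih =>
    have h1 : Tendsto (fun n : ℕ => (u : ℝ) + ((w : ℝ) - a) / n) atTop (𝓝 ((u : ℝ) + 0)) :=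
      tendsto_const_nhds.add (tendsto_const_div_atTop_nhds_zero_nat _)
    rw [add_zero] at h1
    have h2 := (ih.mul h1).div_const ((a : ℝ) + 1)
    have h3 : (u : ℝ) ^ a / (a ! : ℝ) * u / (a + 1) = (u : ℝ) ^ (a + 1) / ((a + 1)! : ℝ) := by
      rw [Nat.factorial_succ]
      push_cast
      field_simp
      ring
    rw [h3] at h2
    refine h2.congr' ?_
    filter_upwards [eventually_gt_atTop 0] with n hn
    have hn' : (n : ℝ) ≠ 0 := Nat.cast_ne_zero.2 hn.ne'
    have h4 : ((u * n + w).choose (a + 1) : ℝ) * (a + 1) =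
        (u * n + w).choose a * (((u * n + w : ℕ) : ℝ) - a) := by
      rcases le_or_gt a (u * n + w) with h | h
      · rw [← Nat.cast_sub h]
        exact_mod_cast Nat.choose_succ_right_eq (u * n + w) a
      · rw [Nat.choose_eq_zero_of_lt h, Nat.choose_eq_zero_of_lt (h.trans a.lt_succ_self)]
        simp
    push_cast at h4
    rw [eq_div_iff (pow_ne_zero _ hn'), div_mul_eq_mul_div, div_eq_iff (by positivity), h4]
    field_simp
    ring

/-- The leading form of the polynomial with binomial coefficients `c`. -/
noncomputable def leadingForm (D : ℕ) (c : ℕ → ℕ → ℚ) (u v : ℝ) : ℝ :=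
  ∑ a ∈ range (D + 1), c a (D - a) * u ^ a * v ^ (D - a) / ((a ! : ℝ) * ((D - a)! : ℝ))

/-- The offsets `w`, `w'` do not affect the limit, so a variable may also be held fixed (slope
zero), as is done later at the threshold of polynomiality. -/
theorem tendsto_binomialSum_div_pow {D : ℕ} {c : ℕ → ℕ → ℚ} (hc : DegreeLE D c) (u w v w' : ℕ) :
    Tendsto (fun n : ℕ => (binomialSum D c (u * n + w) (v * n + w') : ℝ) / (n : ℝ) ^ D) atTop
      (𝓝 (leadingForm D c u v)) := by
  have hterm : ∀ a b, Tendsto (fun n : ℕ => ((c a b : ℝ) * (u * n + w).choose a *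
      (v * n + w').choose b) / (n : ℝ) ^ D) atTop
      (𝓝 (if b = D - a ∧ a ≤ D then c a b * (u : ℝ) ^ a * (v : ℝ) ^ b / ((a ! : ℝ) * (b ! : ℝ))
        else 0)) := by
    intro a b
    rcases lt_trichotomy (a + b) D with h | h | h
    · rw [if_neg (by omega)]
      have h0 := (tendsto_inv_atTop_nhds_zero_nat (𝕜 := ℝ)).pow (D - (a + b))
      rw [zero_pow (by omega)] at h0
      have h1 := (((tendsto_choose_div_pow u w a).mul (tendsto_choose_div_pow v w' b)).const_mul
        (c a b : ℝ)).mul h0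
      rw [mul_zero] at h1
      refine h1.congr' ?_
      filter_upwards [eventually_gt_atTop 0] with n hn
      have hn' : (n : ℝ) ≠ 0 := Nat.cast_ne_zero.2 hn.ne'
      have hD : (n : ℝ) ^ D = n ^ a * n ^ b * n ^ (D - (a + b)) := by
        rw [← pow_add, ← pow_add, Nat.add_sub_cancel' h.le]
      rw [hD, inv_pow]
      field_simp
    · rw [if_pos (by omega)]
      have h1 := ((tendsto_choose_div_pow u w a).mul (tendsto_choose_div_pow v w' b)).const_mul
        (c a b : ℝ)
      convert h1 using 2
      · rw [← h, pow_add]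
        ring
      · ring
    · rw [if_neg (by omega)]
      simp [hc a b h]
  have h := tendsto_finsetSum (range (D + 1)) fun a _ =>
    tendsto_finsetSum (range (D + 1)) fun b _ => hterm a b
  convert h using 2
  · simp only [binomialSum]
    push_cast
    simp only [sum_div]
  · refine sum_congr rfl fun a ha => ?_
    rw [mem_range, Nat.lt_succ_iff] at ha
    simp only [ha, and_true]
    rw [sum_ite_eq', if_pos (mem_range.2 (by omega))]

end Limits

theorem sq_le_mul_of_forall_nat {x y z : ℚ} (hx : 0 < x) (hy : 0 < y)
    (h : ∀ u v : ℕ, 0 < u → 0 < v → 2 * (u * v * y) ≤ u ^ 2 * x + v ^ 2 * z) : y ^ 2 ≤ x * z := by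
  have hxn := Rat.num_pos.2 hx
  have hyn := Rat.num_pos.2 hy
  have hxd := x.den_pos
  have hyd := y.den_pos
  -- Here u : v = y : x after clearing denominators, and the hypothesis becomes 2xy² ≤ xy² + x²z.
  have h1 := h (y.num.toNat * x.den) (x.num.toNat * y.den)
    (Nat.mul_pos (by omega) hxd) (Nat.mul_pos (by omega) hyd)
  have e1 : ((y.num.toNat : ℕ) : ℚ) = y * y.den := by
    rw [Rat.mul_den_eq_num]
    exact_mod_cast Int.toNat_of_nonneg hyn.le
  have e2 : ((x.num.toNat : ℕ) : ℚ) = x * x.den := by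
    rw [Rat.mul_den_eq_num]
    exact_mod_cast Int.toNat_of_nonneg hxn.le
  push_cast at h1
  rw [e1, e2] at h1
  have hxd' : (0 : ℚ) < x.den := by exact_mod_cast hxd
  have hyd' : (0 : ℚ) < y.den := by exact_mod_cast hyd
  have hD : 0 < x * (x.den * y.den : ℚ) ^ 2 := by positivity
  refine le_of_mul_le_mul_left ?_ hD
  linarith

/-! ### The quadratic inequality in dimension two. -/

section DimensionTwo

open IsLocalRing Filter Topology

variable {R : Type u} [CommRing R] [IsLocalRing R] [IsNoetherianRing R] {I J : Ideal R}

/-- Modulo `a` the length function is linear with slope k·c(2,0) in `r`; dividing further by `b ^ m`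
takes its difference of step `l * m`, up to an error at most `G`. The independence of `G` and `N`
from `m` is essential for the limit. -/
theorem exists_colength_span_pow_le (hdim : ringKrullDim R = (2 : ℕ)) (hI : IsCofinite I)
    (hJ : IsCofinite J) {c : ℕ → ℕ → ℚ} (hc : HasBinomialCoeffs 2 I J c) :
    ∃ k : ℕ, k ≠ 0 ∧ ∃ l : ℕ, l ≠ 0 ∧ ∃ a ∈ I ^ k, ∃ b ∈ I ^ l, ∃ (G : ℚ) (N : ℕ), ∀ m : ℕ, ∃ Q, ∀ q ≥ Q, ∀ s ≥ N,
      ∃ n : ℕ, colength (Ideal.span {a} ⊔ (Ideal.span {b ^ m} ⊔ I ^ q * J ^ s)) = n ∧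
        (n : ℚ) ≤ l * m * (k * c 2 0) + G := by
  obtain ⟨k₀, c₀, hk₀⟩ := exists_isSuperficial I J
  obtain ⟨a, ha⟩ := hk₀ (k₀ + 1) (by omega)
  have := isLocalRing_quotient (ha.le_maximalIdeal hI (by omega))
  have hdq := ha.ringKrullDim_quotient hI (by omega) hdim
  have hI₁ := hI.map_quotient (Ideal.span {a})
  have hJ₁ := hJ.map_quotient (Ideal.span {a})
  obtain ⟨p, hp⟩ := exists_hasBinomialCoeffs 1 hdq hI₁ hJ₁
  have hpc := hc.eq_mul_of_isSuperficial one_ne_zero ha hI hJ hp (x := 1) (y := 0) rfl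
  set I₁ := I.map (Ideal.Quotient.mk (Ideal.span {a}))
  set J₁ := J.map (Ideal.Quotient.mk (Ideal.span {a}))
  obtain ⟨l₀, c₁, hl₀⟩ := exists_isSuperficial I₁ J₁
  obtain ⟨b', hb'⟩ := hl₀ (l₀ + 1) (by omega)
  obtain ⟨b, hb, rfl⟩ := (Ideal.mem_map_iff_of_surjective _ Ideal.Quotient.mk_surjective).1
    ((Ideal.map_pow (Ideal.Quotient.mk (Ideal.span {a})) I (l₀ + 1)).symm ▸ hb'.mem)
  obtain ⟨hp, N, hN⟩ := hp
  have hG : colength (I₁ ^ c₁) ≠ ⊤ := by simpa using hI₁.colength_ne_top hJ₁ c₁ 0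
  obtain ⟨G, hG⟩ := ENat.ne_top_iff_exists.1 hG
  refine ⟨k₀ + 1, by omega, l₀ + 1, by omega, a, ha.mem, b, hb, G, N, fun m => ?_⟩
  obtain ⟨M, g, hg, hM⟩ := (hb'.pow m).exists_lengthFun_add hI₁ hJ₁
  rw [← hG, Nat.cast_le] at hg
  refine ⟨M + N + (l₀ + 1) * m, fun q hq s hs => ?_⟩
  obtain ⟨r, rfl⟩ := Nat.exists_eq_add_of_le' ((Nat.le_add_left _ _).trans hq)
  have h1 := congrArg (Nat.cast : ℕ → ℚ) (hM r (by omega) s)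
  have hle : I ^ (r + (l₀ + 1) * m) * J ^ s ≤
      Ideal.span {a} ⊔ (Ideal.span {b ^ m} ⊔ I ^ (r + (l₀ + 1) * m) * J ^ s) :=
    le_sup_right.trans le_sup_right
  have hfin := ne_top_of_le_ne_top (hI.colength_ne_top hJ _ _) (colength_anti hle)
  refine ⟨_, (ENat.natCast_toNat hfin).symm, ?_⟩
  have h2 : lengthFun (I₁.map (Ideal.Quotient.mk (Ideal.span {Ideal.Quotient.mk (Ideal.span {a}) b ^ m})))
      (J₁.map (Ideal.Quotient.mk (Ideal.span {Ideal.Quotient.mk (Ideal.span {a}) b ^ m})))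
      (r + (l₀ + 1) * m) s =
      (colength (Ideal.span {a} ⊔ (Ideal.span {b ^ m} ⊔ I ^ (r + (l₀ + 1) * m) * J ^ s))).toNat := by
    rw [lengthFun, colength_map_span, ← colength_map_quotient (Ideal.span {a}), Ideal.map_sup, Ideal.map_span,
      Set.image_singleton, map_pow, Ideal.map_mul, Ideal.map_pow, Ideal.map_pow]
  have h3 : ∀ r ≥ N, ∀ s ≥ N, (lengthFun I₁ J₁ r s : ℚ) = p 0 0 + p 1 0 * r + p 0 1 * s := by
    intro r hr s hs
    rw [hN r hr s hs]
    simp [binomialSum, Finset.sum_range_succ, hp 1 1 (by norm_num)]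
    ring
  push_cast at h1
  rw [h3 _ (by omega) s hs, h3 _ (by omega) s hs, h2, hpc] at h1
  have hg' : (g : ℚ) ≤ G := Nat.cast_le.2 hg
  push_cast at h1 ⊢
  linarith

/-- If r ≤ kn and r ≤ lm, then I^rJ^s contains (a^n, b^m)J^s + I^qJ^s for q ≥ r. Its colength is at
most 2ℓ(R/J^s) plus n times that of (a, b^m) + I^qJ^s. -/
theorem two_mul_le_of_dim_two (hdim : ringKrullDim R = (2 : ℕ)) (hI : IsCofinite I)
    (hJ : IsCofinite J) {c : ℕ → ℕ → ℚ} (hc : HasBinomialCoeffs 2 I J c) (u v : ℕ) (hu : 0 < u)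
    (hv : 0 < v) : 2 * (u * v * c 1 1) ≤ u ^ 2 * c 2 0 + v ^ 2 * c 0 2 := by
  obtain ⟨k, hk, l, hl, a, ha, b, hb, G, N, h⟩ := exists_colength_span_pow_le hdim hI hJ hc
  obtain ⟨hc, M, hM⟩ := hc
  -- The term ℓ(R/J^s) is replaced by ℓ(R/I^MJ^s), which is no smaller and is given by the
  -- polynomial; `M` is fixed, so only v²c(0,2) survives in the limit.
  have hbound : ∀ n m r s : ℕ, r ≤ k * n → r ≤ l * m → M ≤ r → M ≤ s → N ≤ s →
      binomialSum 2 c r s ≤ 2 * binomialSum 2 c M s + n * (l * m * (k * c 2 0) + G) := by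
    intro n m r s hn hm hMr hMs hNs
    obtain ⟨Q, hQ⟩ := h m
    obtain ⟨e, he, he'⟩ := hQ (max Q r) (le_max_left _ _) s hNs
    have han : a ^ n ∈ I ^ r := Ideal.pow_le_pow_right hn (pow_mul I k n ▸ Ideal.pow_mem_pow ha n)
    have hbm : b ^ m ∈ I ^ r := Ideal.pow_le_pow_right hm (pow_mul I l m ▸ Ideal.pow_mem_pow hb m)
    have h1 : colength (I ^ r * J ^ s) ≤ 2 * colength (I ^ M * J ^ s) + n * e := by
      calc colength (I ^ r * J ^ s)
          ≤ colength (Ideal.span {a ^ n, b ^ m} * J ^ s ⊔ I ^ max Q r * J ^ s) := by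
            refine colength_anti (sup_le (Ideal.mul_mono_left ?_)
              (Ideal.mul_mono_left (Ideal.pow_le_pow_right (le_max_right _ _))))
            rw [Ideal.span_le]
            rintro x (rfl | rfl)
            · exact han
            · exact hbm
        _ ≤ 2 * colength (J ^ s) + colength (Ideal.span {a ^ n, b ^ m} ⊔ I ^ max Q r * J ^ s) :=
            colength_span_pair_mul_sup_le _ _ _ _
        _ ≤ 2 * colength (I ^ M * J ^ s) + n * e := by
            gcongr
            · exact colength_anti Ideal.mul_le_right
            · rw [← he, Ideal.span_insert, sup_assoc]
              exact colength_span_pow_sup_le _ _ _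
    rw [← coe_lengthFun hI hJ, ← coe_lengthFun hI hJ] at h1
    have h2 : lengthFun I J r s ≤ 2 * lengthFun I J M s + n * e := by exact_mod_cast h1
    have h3 : (lengthFun I J r s : ℚ) ≤ 2 * lengthFun I J M s + n * e := by exact_mod_cast h2
    rw [← hM r hMr s hMs, ← hM M le_rfl s hMs]
    refine h3.trans ?_
    gcongr
  have hkl : 0 < k * l := Nat.pos_of_ne_zero (mul_ne_zero hk hl)
  have hlim1 := tendsto_binomialSum_div_pow hc (k * l * u) 0 (k * l * v) 0
  have hlim2 := (tendsto_binomialSum_div_pow hc 0 M (k * l * v) 0).const_mul (2 : ℝ)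
  have hlim3 : Tendsto (fun t : ℕ => ((l * u : ℕ) : ℝ) * (l * (k * u : ℕ) * (k * c 2 0) + G / t))
      atTop (𝓝 (((l * u : ℕ) : ℝ) * (l * (k * u : ℕ) * (k * c 2 0) + 0))) :=
    (tendsto_const_nhds.add (tendsto_const_div_atTop_nhds_zero_nat _)).const_mul _
  have hle := le_of_tendsto_of_tendsto hlim1 (hlim2.add hlim3) (by
    filter_upwards [eventually_ge_atTop (M + N + 1)] with t ht
    have hge : ∀ x, 0 < x → t ≤ k * l * x * t := fun x hx =>
      Nat.le_mul_of_pos_left _ (Nat.mul_pos hkl hx)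
    -- The values make r = kn = lm = klut and s = klvt. Division by t² leaves the common factor
    -- (kl)² on both sides.
    have hb := hbound (l * u * t) (k * u * t) (k * l * u * t) (k * l * v * t)
      (le_of_eq (by ring)) (le_of_eq (by ring)) (by have := hge u hu; omega)
      (by have := hge v hv; omega) (by have := hge v hv; omega)
    have hb' : (binomialSum 2 c (k * l * u * t) (k * l * v * t) : ℝ) ≤
        2 * binomialSum 2 c M (k * l * v * t) +
          (l * u * t : ℕ) * (l * (k * u * t : ℕ) * (k * c 2 0) + G) := by
      exact_mod_cast hb
    have ht0 : (0 : ℝ) < t := by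
      have : 0 < t := by omega
      exact_mod_cast this
    simp only [add_zero, zero_mul, zero_add]
    rw [div_le_iff₀ (by positivity)]
    refine hb'.trans (le_of_eq ?_)
    push_cast
    field_simp)
  simp only [leadingForm, Finset.sum_range_succ, Finset.sum_range_zero] at hle
  norm_num [Nat.factorial] at hle
  have hL : (0 : ℝ) < (k * l : ℝ) ^ 2 := by
    have : (0 : ℝ) < (k * l : ℕ) := by exact_mod_cast hkl
    push_cast at this
    positivity
  have hfin : (2 * (u * v * c 1 1) : ℝ) ≤ u ^ 2 * c 2 0 + v ^ 2 * c 0 2 := by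
    refine le_of_mul_le_mul_left ?_ hL
    linarith
  exact_mod_cast hfin

end DimensionTwo

/-- A superficial quotient multiplies all three coefficients by the same order, so both sides scale
by its square until dimension two is reached. -/
theorem hasBinomialCoeffs_sq_le (d : ℕ) : ∀ {R : Type u} [CommRing R] [IsLocalRing R]
    [IsNoetherianRing R], ringKrullDim R = (d + 2 : ℕ) → ∀ {I J : Ideal R}, IsCofinite I →
      IsCofinite J → ∀ {c}, HasBinomialCoeffs (d + 2) I J c → ∀ x y, x + y = d →
        c (x + 1) (y + 1) ^ 2 ≤ c (x + 2) y * c x (y + 2) := by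
  induction d with
  | zero =>
    intro R _ _ _ hd I J hI hJ c h x y hxy
    obtain ⟨rfl, rfl⟩ : x = 0 ∧ y = 0 := by omega
    exact sq_le_mul_of_forall_nat (hasBinomialCoeffs_pos 2 hd hI hJ h 2 0 rfl)
      (hasBinomialCoeffs_pos 2 hd hI hJ h 1 1 rfl) (two_mul_le_of_dim_two hd hI hJ h)
  | succ d ih =>
    intro R _ _ _ hd I J hI hJ c h x y hxy
    have key : ∀ {I J : Ideal R}, IsCofinite I → IsCofinite J → ∀ {c},
        HasBinomialCoeffs (d + 1 + 2) I J c → ∀ x y, x + y = d →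
          c (x + 1 + 1) (y + 1) ^ 2 ≤ c (x + 1 + 2) y * c (x + 1) (y + 2) := by
      intro I J hI hJ c h x y hxy
      obtain ⟨k₀, c₀, hk⟩ := exists_isSuperficial I J
      obtain ⟨a, ha⟩ := hk (k₀ + 1) (by omega)
      have := isLocalRing_quotient (ha.le_maximalIdeal hI (by omega))
      have hdq := ha.ringKrullDim_quotient (d := d + 2) hI (by omega) hd
      obtain ⟨p, hp⟩ := exists_hasBinomialCoeffs (d + 2) hdq (hI.map_quotient _)
        (hJ.map_quotient _)
      have h1 := ih hdq (hI.map_quotient _) (hJ.map_quotient _) hp x y hxy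
      have h2 := fun x y => h.eq_mul_of_isSuperficial (d := d + 2) (by omega) ha hI hJ hp
        (x := x) (y := y)
      rw [h2 (x + 1) (y + 1) (by omega), h2 (x + 2) y (by omega), h2 x (y + 2) (by omega)] at h1
      refine le_of_mul_le_mul_left (a := ((k₀ + 1 : ℕ) : ℚ) ^ 2) ?_ (by positivity)
      linarith
    cases x with
    | succ x => exact key hI hJ h x y (by omega)
    | zero =>
      obtain ⟨y, rfl⟩ : ∃ z, y = z + 1 := ⟨d, by omega⟩
      rw [mul_comm]
      exact key hJ hI h.swap y 0 (by omega)

/-! ### From binomial coefficients to polynomials. -/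

section ToMvPolynomial

open Polynomial Finset

/-- The polynomial `x ↦ x choose a`. -/
noncomputable def choosePolynomial (a : ℕ) : ℚ[X] := C ((a ! : ℚ)⁻¹) * descPochhammer ℚ a

theorem choosePolynomial_eval (a n : ℕ) : (choosePolynomial a).eval (n : ℚ) = n.choose a := by
  rw [choosePolynomial, eval_mul, eval_C, descPochhammer_eval_eq_descFactorial,
    Nat.descFactorial_eq_factorial_mul_choose, Nat.cast_mul, inv_mul_cancel_left₀]
  exact_mod_cast a.factorial_ne_zero

theorem choosePolynomial_coeff_self (a : ℕ) : (choosePolynomial a).coeff a = (a ! : ℚ)⁻¹ := by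
  rw [choosePolynomial, coeff_C_mul]
  have := (monic_descPochhammer ℚ a).coeff_natDegree
  rw [descPochhammer_natDegree] at this
  rw [this, mul_one]

theorem choosePolynomial_coeff_of_lt {a m : ℕ} (h : a < m) : (choosePolynomial a).coeff m = 0 := by
  rw [choosePolynomial, coeff_C_mul, coeff_eq_zero_of_natDegree_lt, mul_zero]
  rwa [descPochhammer_natDegree]

theorem coeff_aeval_X_mul_aeval_X (p q : ℚ[X]) (m : Fin 2 →₀ ℕ) :
    (aeval (MvPolynomial.X (R := ℚ) (0 : Fin 2)) p *
      aeval (MvPolynomial.X (R := ℚ) (1 : Fin 2)) q).coeff m = p.coeff (m 0) * q.coeff (m 1) := by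
  classical
  induction p using Polynomial.induction_on' with
  | add p p' h h' => rw [map_add, add_mul, MvPolynomial.coeff_add, h, h', coeff_add, add_mul]
  | monomial i x =>
    induction q using Polynomial.induction_on' with
    | add q q' h h' => rw [map_add, mul_add, MvPolynomial.coeff_add, h, h', coeff_add, mul_add]
    | monomial j y =>
      rw [aeval_monomial, aeval_monomial, MvPolynomial.algebraMap_eq,
        MvPolynomial.C_mul_X_pow_eq_monomial, MvPolynomial.C_mul_X_pow_eq_monomial,
        MvPolynomial.monomial_mul, MvPolynomial.coeff_monomial, coeff_monomial, coeff_monomial,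
        ite_zero_mul_ite_zero]
      refine if_congr ?_ rfl rfl
      constructor
      · rintro rfl
        simp
      · rintro ⟨rfl, rfl⟩
        ext t
        fin_cases t <;> simp

/-- The bivariate polynomial with binomial coefficients `c`. -/
noncomputable def binomialPolynomial (D : ℕ) (c : ℕ → ℕ → ℚ) : MvPolynomial (Fin 2) ℚ :=
  ∑ a ∈ range (D + 1), ∑ b ∈ range (D + 1), MvPolynomial.C (c a b) *
    (aeval (MvPolynomial.X (0 : Fin 2)) (choosePolynomial a) *
      aeval (MvPolynomial.X (1 : Fin 2)) (choosePolynomial b))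

theorem binomialPolynomial_eval (D : ℕ) (c : ℕ → ℕ → ℚ) (r s : ℕ) :
    MvPolynomial.eval ![(r : ℚ), (s : ℚ)] (binomialPolynomial D c) = binomialSum D c r s := by
  have h : ∀ (t : Fin 2) (p : ℚ[X]), MvPolynomial.eval ![(r : ℚ), (s : ℚ)]
      (aeval (MvPolynomial.X t) p) = p.eval (![(r : ℚ), (s : ℚ)] t) := by
    intro t p
    rw [← MvPolynomial.coe_aeval_eq_eval, RingHom.coe_coe, ← aeval_algHom_apply,
      MvPolynomial.aeval_X, coe_aeval_eq_eval]
  simp only [binomialPolynomial, binomialSum, map_sum, map_mul, h, MvPolynomial.eval_C]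
  refine sum_congr rfl fun a _ => sum_congr rfl fun b _ => ?_
  rw [← mul_assoc]
  simp [choosePolynomial_eval]

theorem binomialPolynomial_coeff (D : ℕ) (c : ℕ → ℕ → ℚ) (m : Fin 2 →₀ ℕ) :
    (binomialPolynomial D c).coeff m = ∑ a ∈ range (D + 1), ∑ b ∈ range (D + 1),
      c a b * ((choosePolynomial a).coeff (m 0) * (choosePolynomial b).coeff (m 1)) := by
  simp only [binomialPolynomial, MvPolynomial.coeff_sum, MvPolynomial.coeff_C_mul,
    coeff_aeval_X_mul_aeval_X]

theorem binomialPolynomial_coeff_of_lt {D : ℕ} {c : ℕ → ℕ → ℚ} (hc : DegreeLE D c)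
    {m : Fin 2 →₀ ℕ} (hm : D < m 0 + m 1) : (binomialPolynomial D c).coeff m = 0 := by
  rw [binomialPolynomial_coeff]
  refine sum_eq_zero fun a _ => sum_eq_zero fun b _ => ?_
  by_cases h0 : a < m 0
  · simp [choosePolynomial_coeff_of_lt h0]
  by_cases h1 : b < m 1
  · simp [choosePolynomial_coeff_of_lt h1]
  rw [hc a b (by omega), zero_mul]

theorem binomialPolynomial_coeff_of_eq {D : ℕ} {c : ℕ → ℕ → ℚ} (hc : DegreeLE D c)
    {m : Fin 2 →₀ ℕ} (hm : m 0 + m 1 = D) :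
    (binomialPolynomial D c).coeff m = c (m 0) (m 1) * ((m 0)! : ℚ)⁻¹ * ((m 1)! : ℚ)⁻¹ := by
  rw [binomialPolynomial_coeff, sum_eq_single (m 0), sum_eq_single (m 1)]
  · rw [choosePolynomial_coeff_self, choosePolynomial_coeff_self, mul_assoc]
  · intro b _ hb
    rcases lt_or_gt_of_ne hb with h | h
    · simp [choosePolynomial_coeff_of_lt h]
    · rw [hc _ _ (by omega), zero_mul]
  · exact fun h => absurd (mem_range.2 (by omega)) h
  · intro a _ ha
    refine sum_eq_zero fun b _ => ?_
    rcases lt_or_gt_of_ne ha with h | h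
    · simp [choosePolynomial_coeff_of_lt h]
    · by_cases h1 : b < m 1
      · simp [choosePolynomial_coeff_of_lt h1]
      · rw [hc _ _ (by omega), zero_mul]
  · exact fun h => absurd (mem_range.2 (by omega)) h

theorem binomialPolynomial_totalDegree {D : ℕ} {c : ℕ → ℕ → ℚ} (hc : DegreeLE D c)
    (h : c D 0 ≠ 0) : (binomialPolynomial D c).totalDegree = D := by
  have hsum : ∀ m : Fin 2 →₀ ℕ, (m.sum fun _ e => e) = m 0 + m 1 := by
    intro m
    rw [Finsupp.sum_fintype _ _ (fun _ => rfl), Fin.sum_univ_two]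
  refine le_antisymm ?_ ?_
  · refine Finset.sup_le fun m hm => ?_
    by_contra! hlt
    exact MvPolynomial.mem_support_iff.1 hm
      (binomialPolynomial_coeff_of_lt hc (by simpa [hsum] using hlt))
  · have hmem : Finsupp.single 0 D ∈ (binomialPolynomial D c).support := by
      rw [MvPolynomial.mem_support_iff, binomialPolynomial_coeff_of_eq hc (by simp)]
      have : (D ! : ℚ) ≠ 0 := by exact_mod_cast D.factorial_ne_zero
      simpa using ⟨h, D.factorial_ne_zero⟩
    simpa [hsum] using MvPolynomial.le_totalDegree hmem

end ToMvPolynomial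

/-! ### Degree and leading coefficient read off from growth. -/

section PolynomialLimits

open Filter Topology Polynomial

theorem tendsto_eval_div_pow (q : ℝ[X]) :
    Tendsto (fun n : ℕ => q.eval (n : ℝ) / (n : ℝ) ^ q.natDegree) atTop (𝓝 q.leadingCoeff) := by
  by_cases hq : q = 0
  · simp [hq]
  have h := Polynomial.div_tendsto_atTop_leadingCoeff_div_of_degree_eq q (X ^ q.natDegree)
    (by rw [degree_X_pow, degree_eq_natDegree hq])
  simp only [eval_pow, eval_X, leadingCoeff_X_pow, div_one] at h
  exact h.comp tendsto_natCast_atTop_atTop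

theorem natDegree_eq_of_tendsto_eval_div_pow {q : ℝ[X]} {d : ℕ} {L : ℝ} (hL : L ≠ 0)
    (h : Tendsto (fun n : ℕ => q.eval (n : ℝ) / (n : ℝ) ^ d) atTop (𝓝 L)) :
    q.natDegree = d ∧ q.leadingCoeff = L := by
  have hq := tendsto_eval_div_pow q
  have key : ∀ {e e' : ℕ} {L : ℝ}, e < e' →
      Tendsto (fun n : ℕ => q.eval (n : ℝ) / (n : ℝ) ^ e) atTop (𝓝 L) →
      Tendsto (fun n : ℕ => q.eval (n : ℝ) / (n : ℝ) ^ e') atTop (𝓝 0) := by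
    intro e e' L he h
    have h0 := (tendsto_inv_atTop_nhds_zero_nat (𝕜 := ℝ)).pow (e' - e)
    rw [zero_pow (by omega)] at h0
    have h1 := h.mul h0
    rw [mul_zero] at h1
    refine h1.congr' ?_
    filter_upwards [eventually_gt_atTop 0] with n hn
    have hn' : (n : ℝ) ≠ 0 := Nat.cast_ne_zero.2 hn.ne'
    rw [show (n : ℝ) ^ e' = n ^ e * n ^ (e' - e) by rw [← pow_add, Nat.add_sub_cancel' he.le],
      inv_pow]
    field_simp
  rcases lt_trichotomy q.natDegree d with hlt | heq | hlt
  · exact absurd (tendsto_nhds_unique h (key hlt hq)) hL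
  · subst heq
    exact ⟨rfl, tendsto_nhds_unique hq h⟩
  · have h0 := tendsto_nhds_unique hq (key hlt h)
    rw [leadingCoeff_eq_zero] at h0
    simp [h0] at hlt

end PolynomialLimits

theorem leadingForm_one_zero (d : ℕ) (c : ℕ → ℕ → ℚ) :
    leadingForm d c 1 0 = c d 0 / (d ! : ℝ) := by
  rw [leadingForm, Finset.sum_eq_single d]
  · simp
  · intro a ha had
    rw [Finset.mem_range] at ha
    rw [zero_pow (by omega)]
    simp
  · simp

theorem leadingForm_one_one (d : ℕ) (c : ℕ → ℕ → ℚ) :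
    (d ! : ℝ) * leadingForm d c 1 1 = ∑ a ∈ Finset.range (d + 1), d.choose a * (c a (d - a) : ℝ) := by
  rw [leadingForm, Finset.mul_sum]
  refine Finset.sum_congr rfl fun a ha => ?_
  rw [Finset.mem_range, Nat.lt_succ_iff] at ha
  rw [Nat.cast_choose ℝ ha]
  ring

/-! ### Consequences of log-convexity for real and rational sequences. -/

section LogConvex

/-- The ratios increase, so with ρ = E(i+1)/E(i) one has E(i) ≤ E(0)ρ^i and E(i)ρ^(d-i) ≤ E(d).
Eliminate ρ. -/
theorem pow_le_pow_mul_pow_of_sq_le {E : ℕ → ℚ} {d : ℕ} (hE : ∀ i ≤ d, 0 < E i)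
    (h : ∀ i, i + 2 ≤ d → E (i + 1) ^ 2 ≤ E i * E (i + 2)) {i : ℕ} (hi : i ≤ d) :
    E i ^ d ≤ E 0 ^ (d - i) * E d ^ i := by
  -- The case i = d is set apart because ρ involves `E (i + 1)`.
  obtain rfl | hlt := hi.eq_or_lt
  · simp
  have hmono : ∀ m j, j + m + 1 ≤ d → E (j + 1) / E j ≤ E (j + m + 1) / E (j + m) := by
    intro m j
    induction m with
    | zero => intro; exact le_rfl
    | succ m ih =>
      intro hm
      refine (ih (by omega)).trans ?_
      rw [div_le_div_iff₀ (hE _ (by omega)) (hE _ (by omega))]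
      have := h (j + m) (by omega)
      calc E (j + m + 1) * E (j + (m + 1)) = E (j + m + 1) ^ 2 := by
            rw [show j + (m + 1) = j + m + 1 by ring]; ring
        _ ≤ E (j + m) * E (j + m + 2) := this
        _ = E (j + (m + 1) + 1) * E (j + m) := by
            rw [show j + (m + 1) + 1 = j + m + 2 by ring]; ring
  set ρ := E (i + 1) / E i with hρ
  have hρ0 : 0 < ρ := div_pos (hE _ (by omega)) (hE _ hi)
  have hdown : ∀ m ≤ i, E i ≤ E (i - m) * ρ ^ m := by
    intro m
    induction m with
    | zero => simp
    | succ m ih =>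
      intro hm
      refine (ih (by omega)).trans ?_
      have h1 := hmono (m + 1) (i - (m + 1)) (by omega)
      rw [show i - (m + 1) + (m + 1) = i by omega, ← hρ, show i - (m + 1) + 1 = i - m by omega,
        div_le_iff₀ (hE _ (by omega))] at h1
      calc E (i - m) * ρ ^ m ≤ ρ * E (i - (m + 1)) * ρ ^ m := by gcongr
        _ = _ := by ring
  have hup : ∀ m, i + m ≤ d → E i * ρ ^ m ≤ E (i + m) := by
    intro m
    induction m with
    | zero => simp
    | succ m ih =>
      intro hm
      have h1 := hmono m i (by omega)
      rw [← hρ, le_div_iff₀ (hE _ (by omega))] at h1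
      calc E i * ρ ^ (m + 1) = ρ * (E i * ρ ^ m) := by ring
        _ ≤ ρ * E (i + m) := by gcongr; exact ih (by omega)
        _ ≤ _ := h1
  have h1 := hdown i le_rfl
  have h2 := hup (d - i) (by omega)
  rw [Nat.sub_self] at h1
  rw [Nat.add_sub_cancel' hi] at h2
  have hi0 := (hE i hi).le
  have h00 := (hE 0 (Nat.zero_le _)).le
  calc E i ^ d = E i ^ (d - i) * E i ^ i := by rw [← pow_add, Nat.sub_add_cancel hi]
    _ ≤ (E 0 * ρ ^ i) ^ (d - i) * E i ^ i := by gcongr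
    _ = E 0 ^ (d - i) * (E i * ρ ^ (d - i)) ^ i := by
        rw [mul_pow, mul_pow, ← pow_mul, ← pow_mul, mul_comm i]
        ring
    _ ≤ E 0 ^ (d - i) * E d ^ i := by gcongr

/-- With α, β the d-th roots of `x`, `y`, each E(a) is at most α^a β^(d-a); sum by the binomial
theorem. -/
theorem rpow_le_add_rpow {d : ℕ} (hd : d ≠ 0) {x y : ℝ} (hx : 0 ≤ x) (hy : 0 ≤ y) {E : ℕ → ℝ}
    (hE : ∀ a ≤ d, 0 ≤ E a) (h : ∀ a ≤ d, E a ^ d ≤ x ^ a * y ^ (d - a)) :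
    (∑ a ∈ Finset.range (d + 1), d.choose a * E a) ^ (1 / (d : ℝ)) ≤
      x ^ (1 / (d : ℝ)) + y ^ (1 / (d : ℝ)) := by
  have hx' : (x ^ (1 / (d : ℝ))) ^ d = x := by
    rw [one_div]; exact Real.rpow_inv_natCast_pow hx hd
  have hy' : (y ^ (1 / (d : ℝ))) ^ d = y := by
    rw [one_div]; exact Real.rpow_inv_natCast_pow hy hd
  set α := x ^ (1 / (d : ℝ)) with hα
  set β := y ^ (1 / (d : ℝ)) with hβ
  have hα0 : 0 ≤ α := Real.rpow_nonneg hx _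
  have hβ0 : 0 ≤ β := Real.rpow_nonneg hy _
  have hsum : ∑ a ∈ Finset.range (d + 1), d.choose a * E a ≤ (α + β) ^ d := by
    rw [add_pow]
    refine Finset.sum_le_sum fun a ha => ?_
    rw [Finset.mem_range, Nat.lt_succ_iff] at ha
    rw [mul_comm]
    gcongr
    refine (pow_le_pow_iff_left₀ (hE a ha) (by positivity) hd).1 ((h a ha).trans (le_of_eq ?_))
    rw [← hx', ← hy', mul_pow, ← pow_mul, ← pow_mul, ← pow_mul, ← pow_mul, mul_comm d a,
      mul_comm d (d - a)]
  have h0 : 0 ≤ ∑ a ∈ Finset.range (d + 1), (d.choose a : ℝ) * E a :=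
    Finset.sum_nonneg fun a ha => mul_nonneg (Nat.cast_nonneg _)
      (hE a (by rw [Finset.mem_range] at ha; omega))
  refine (Real.rpow_le_rpow h0 hsum (by positivity)).trans (le_of_eq ?_)
  rw [one_div]
  exact Real.pow_rpow_inv_natCast (by positivity) hd

end LogConvex

/-! ### Identification of the multiplicities with top coefficients. -/

section Multiplicities

open IsLocalRing Filter Topology

theorem IsBhattacharyaPolynomial.eq {R : Type u} [CommRing R] {I J : Ideal R}
    {P : MvPolynomial (Fin 2) ℚ} (h : IsBhattacharyaPolynomial I J P) :
    bhattacharyaPolynomial I J = P := by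
  have hex : ∃ P, IsBhattacharyaPolynomial I J P := ⟨P, h⟩
  rw [bhattacharyaPolynomial, dif_pos hex]
  exact hex.choose_spec.unique h

theorem IsHilbertPolynomial.eq {R : Type u} [CommRing R] {I : Ideal R}
    {p : Polynomial ℚ} (h : IsHilbertPolynomial I p) : hilbertSamuelPolynomial I = p := by
  have hex : ∃ p, IsHilbertPolynomial I p := ⟨p, h⟩
  rw [hilbertSamuelPolynomial, dif_pos hex]
  exact hex.choose_spec.unique h

variable {R : Type u} [CommRing R] [IsLocalRing R] [IsNoetherianRing R] {I J : Ideal R}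

theorem HasBinomialCoeffs.isBhattacharyaPolynomial {d : ℕ} {c : ℕ → ℕ → ℚ}
    (h : HasBinomialCoeffs d I J c) (hI : IsCofinite I) (hJ : IsCofinite J) :
    IsBhattacharyaPolynomial I J (binomialPolynomial d c) := by
  obtain ⟨hc, N, hN⟩ := h
  refine ⟨N, fun r s hr hs => ⟨lengthFun I J r s, (coe_lengthFun hI hJ r s).symm, ?_⟩⟩
  rw [binomialPolynomial_eval, hN r hr s hs]

theorem HasBinomialCoeffs.mixedMultiplicity_eq {d : ℕ} {c : ℕ → ℕ → ℚ}
    (h : HasBinomialCoeffs d I J c) (hI : IsCofinite I) (hJ : IsCofinite J) {i : ℕ} (hi : i ≤ d) :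
    mixedMultiplicity d I J i = c (d - i) i := by
  rw [mixedMultiplicity, (h.isBhattacharyaPolynomial hI hJ).eq,
    binomialPolynomial_coeff_of_eq h.1 (by simp [hi]), Nat.cast_choose ℚ hi]
  have h1 : (d ! : ℚ) ≠ 0 := by exact_mod_cast d.factorial_ne_zero
  have h2 : (i ! : ℚ) ≠ 0 := by exact_mod_cast i.factorial_ne_zero
  have h3 : ((d - i)! : ℚ) ≠ 0 := by exact_mod_cast (d - i).factorial_ne_zero
  simp
  field_simp

theorem hilbertSamuelPolynomial_spec {d : ℕ} {c : ℕ → ℕ → ℚ} (h : HasBinomialCoeffs d I I c)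
    (hI : IsCofinite I) (hpos : 0 < c d 0) :
    IsHilbertPolynomial I (hilbertSamuelPolynomial I) ∧
      (hilbertSamuelPolynomial I).natDegree = d ∧ idealMultiplicity d I = c d 0 := by
  obtain ⟨hc, N, hN⟩ := h
  let ψ : MvPolynomial (Fin 2) ℚ →ₐ[ℚ] Polynomial ℚ :=
    MvPolynomial.aeval ![Polynomial.X, Polynomial.C (N : ℚ)]
  -- With J = I and second exponent fixed at `N`, `q` gives ℓ(R/I^(r+N)) as a polynomial in `r`;
  -- substituting n - N for `r` yields the Hilbert polynomial.
  let q := ψ (binomialPolynomial d c)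
  have hq : ∀ n : ℕ, q.eval (n : ℚ) = binomialSum d c n N := by
    intro n
    rw [← binomialPolynomial_eval]
    have : (Polynomial.aeval (n : ℚ)).comp ψ = MvPolynomial.aeval ![(n : ℚ), (N : ℚ)] := by
      apply MvPolynomial.algHom_ext
      intro t
      fin_cases t <;> simp [ψ]
    have h2 := DFunLike.congr_fun this (binomialPolynomial d c)
    simpa [q, Polynomial.coe_aeval_eq_eval, MvPolynomial.coe_aeval_eq_eval] using h2
  have hlim := tendsto_binomialSum_div_pow hc 1 0 0 N
  have hdf : (0 : ℝ) < d ! := by exact_mod_cast d.factorial_pos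
  have hlead : leadingForm d c ((1 : ℕ) : ℝ) ((0 : ℕ) : ℝ) = c d 0 / (d ! : ℝ) := by
    simpa using leadingForm_one_zero d c
  have hL : (c d 0 / (d ! : ℝ)) ≠ 0 := by
    have : (0 : ℝ) < c d 0 := by exact_mod_cast hpos
    positivity
  rw [hlead] at hlim
  have hq' : ∀ n : ℕ, (q.map (algebraMap ℚ ℝ)).eval (n : ℝ) = (binomialSum d c n N : ℝ) := by
    intro n
    rw [Polynomial.eval_natCast_map, hq]
    simp
  obtain ⟨hdeg, hcoeff⟩ := natDegree_eq_of_tendsto_eval_div_pow hL (q := q.map (algebraMap ℚ ℝ))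
    (by simpa only [hq', one_mul, zero_mul, add_zero, zero_add] using hlim)
  rw [Polynomial.natDegree_map] at hdeg
  rw [Polynomial.leadingCoeff_map] at hcoeff
  have hH : IsHilbertPolynomial I (q.comp (Polynomial.X - Polynomial.C (N : ℚ))) := by
    refine ⟨N + N, fun n hn => ?_⟩
    obtain ⟨r, rfl⟩ := Nat.exists_eq_add_of_le' ((Nat.le_add_left N N).trans hn)
    refine ⟨lengthFun I I r N, ?_, ?_⟩
    · rw [coe_lengthFun hI hI, ← pow_add]
      rfl
    · rw [hN r (by omega) N le_rfl, ← hq, Polynomial.eval_comp]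
      simp
  have hdeg' : (q.comp (Polynomial.X - Polynomial.C (N : ℚ))).natDegree = d := by
    rw [Polynomial.natDegree_comp, Polynomial.natDegree_X_sub_C, mul_one, hdeg]
  refine ⟨hH.eq.symm ▸ hH, hH.eq.symm ▸ hdeg', ?_⟩
  rw [idealMultiplicity, hH.eq]
  nth_rw 2 [← hdeg']
  rw [Polynomial.coeff_natDegree, Polynomial.leadingCoeff_comp (by rw [Polynomial.natDegree_X_sub_C]; exact one_ne_zero),
    Polynomial.leadingCoeff_X_sub_C, one_pow, mul_one]
  have : (algebraMap ℚ ℝ) (d ! * q.leadingCoeff) = algebraMap ℚ ℝ (c d 0) := by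
    rw [map_mul, hcoeff]
    simp
    field_simp
  exact (algebraMap ℚ ℝ).injective this

/-- The coefficient of index (d,0) does not depend on the second ideal: a fixed power of `J'` lies
in J^N, and fixed second exponents do not affect the limit. Taking I for one of the two ideals, in
both directions, identifies it with e(I). -/
theorem HasBinomialCoeffs.apply_zero_le {J' : Ideal R} {d : ℕ} {c c' : ℕ → ℕ → ℚ}
    (h : HasBinomialCoeffs d I J c) (h' : HasBinomialCoeffs d I J' c') (hI : IsCofinite I)
    (hJ : IsCofinite J) (hJ' : IsCofinite J') : c d 0 ≤ c' d 0 := by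
  obtain ⟨hc, N, hN⟩ := h
  obtain ⟨hc', N', hN'⟩ := h'
  obtain ⟨n, hn⟩ := hJ.2
  have hle : J' ^ (N' + n * N) ≤ J ^ N := by
    refine (Ideal.pow_le_pow_right (Nat.le_add_left _ _)).trans ?_
    rw [pow_mul]
    exact Ideal.pow_right_mono ((Ideal.pow_right_mono hJ'.1 n).trans hn) N
  have hlim := tendsto_binomialSum_div_pow hc 1 0 0 N
  have hlim' := tendsto_binomialSum_div_pow hc' 1 0 0 (N' + n * N)
  have := le_of_tendsto_of_tendsto hlim hlim' (by
    filter_upwards [eventually_ge_atTop (N + N')] with t ht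
    have h1 : (colength (I ^ t * J ^ N)) ≤ colength (I ^ t * J' ^ (N' + n * N)) :=
      colength_anti (Ideal.mul_mono_right hle)
    rw [← coe_lengthFun hI hJ, ← coe_lengthFun hI hJ', Nat.cast_le] at h1
    have h2 : (lengthFun I J t N : ℚ) ≤ lengthFun I J' t (N' + n * N) := by exact_mod_cast h1
    rw [hN t (by omega) N le_rfl, hN' t (by omega) _ (by omega)] at h2
    simp only [one_mul, zero_mul, zero_add, add_zero]
    gcongr)
  simp only [Nat.cast_one, Nat.cast_zero, leadingForm_one_zero] at this
  have hdf : (0 : ℝ) < d ! := by exact_mod_cast d.factorial_pos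
  rw [div_le_div_iff_of_pos_right hdf] at this
  exact_mod_cast this

theorem hilbertSamuelPolynomial_of_isCofinite {d : ℕ} (hd : ringKrullDim R = d)
    (hI : IsCofinite I) : IsHilbertPolynomial I (hilbertSamuelPolynomial I) ∧
      (hilbertSamuelPolynomial I).natDegree = d := by
  obtain ⟨c, hc⟩ := exists_hasBinomialCoeffs d hd hI hI
  obtain ⟨h1, h2, -⟩ := hilbertSamuelPolynomial_spec hc hI
    (hasBinomialCoeffs_pos d hd hI hI hc d 0 rfl)
  exact ⟨h1, h2⟩

theorem HasBinomialCoeffs.idealMultiplicity_eq {d : ℕ} (hd : ringKrullDim R = d)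
    {c : ℕ → ℕ → ℚ} (h : HasBinomialCoeffs d I J c) (hI : IsCofinite I) (hJ : IsCofinite J) :
    idealMultiplicity d I = c d 0 := by
  obtain ⟨c', hc'⟩ := exists_hasBinomialCoeffs d hd hI hI
  rw [(hilbertSamuelPolynomial_spec hc' hI (hasBinomialCoeffs_pos d hd hI hI hc' d 0 rfl)).2.2]
  exact le_antisymm (hc'.apply_zero_le h hI hI hJ) (h.apply_zero_le hc' hI hJ hI)

/-- On the diagonal I^nJ^n = (IJ)^n, so the leading form at (1,1) is the leading coefficient for `I
* J`. -/
theorem HasBinomialCoeffs.idealMultiplicity_mul_eq {d : ℕ} (hd : ringKrullDim R = d)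
    {c : ℕ → ℕ → ℚ} (h : HasBinomialCoeffs d I J c) (hI : IsCofinite I) (hJ : IsCofinite J) :
    (idealMultiplicity d (I * J) : ℝ) =
      ∑ a ∈ Finset.range (d + 1), d.choose a * (c a (d - a) : ℝ) := by
  obtain ⟨⟨M, hM⟩, h2⟩ := hilbertSamuelPolynomial_of_isCofinite hd (hI.mul hJ)
  obtain ⟨hc, N, hN⟩ := h
  have hlim := tendsto_binomialSum_div_pow hc 1 0 1 0
  have hlim' := tendsto_eval_div_pow
    ((hilbertSamuelPolynomial (I * J)).map (algebraMap ℚ ℝ))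
  rw [Polynomial.leadingCoeff_map, Polynomial.natDegree_map, h2] at hlim'
  have := tendsto_nhds_unique hlim (hlim'.congr' (by
    filter_upwards [eventually_ge_atTop (M + N)] with n hn
    obtain ⟨l, hl, hl'⟩ := hM n (by omega)
    have h3 : l = lengthFun I J n n := by
      have := coe_lengthFun hI hJ n n
      rw [← mul_pow] at this
      exact_mod_cast hl.symm.trans this.symm
    rw [← hN (1 * n + 0) (by omega) (1 * n + 0) (by omega), one_mul, add_zero, ← h3]
    congr 1
    rw [Polynomial.eval_natCast_map, hl']
    simp))
  simp only [Nat.cast_one] at this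
  rw [← leadingForm_one_one, this, idealMultiplicity, Polynomial.leadingCoeff, h2]
  simp

end Multiplicities

/-! ### The theorem of Rees and Sharp. -/

theorem theorem5p4 {R : Type*} [CommRing R] [IsLocalRing R] [IsNoetherianRing R]
    (d : ℕ) (hd : 2 ≤ d) (hdim : ringKrullDim R = (d : WithBot ℕ∞))
    (I J : Ideal R) (hI : IsMaxPrimary I) (hJ : IsMaxPrimary J) :
    -- the multiplicities and mixed multiplicities are well defined
    (∀ K : Ideal R, IsMaxPrimary K →
      IsHilbertPolynomial K (hilbertSamuelPolynomial K) ∧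
        (hilbertSamuelPolynomial K).natDegree = d) ∧
    IsBhattacharyaPolynomial I J (bhattacharyaPolynomial I J) ∧
    (bhattacharyaPolynomial I J).totalDegree = d ∧
    (∀ i : ℕ, i ≤ d → 0 < mixedMultiplicity d I J i) ∧
    -- the ratios of consecutive mixed multiplicities increase
    (∀ i : ℕ, i + 2 ≤ d →
      mixedMultiplicity d I J (i + 1) / mixedMultiplicity d I J i ≤
        mixedMultiplicity d I J (i + 2) / mixedMultiplicity d I J (i + 1)) ∧
    -- the bound by the multiplicities of the two ideals
    (∀ i : ℕ, i ≤ d →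
      mixedMultiplicity d I J i ^ d ≤
        idealMultiplicity d I ^ (d - i) * idealMultiplicity d J ^ i) ∧
    -- the inequality of Minkowski
    (idealMultiplicity d (I * J) : ℝ) ^ (1 / (d : ℝ)) ≤
      (idealMultiplicity d I : ℝ) ^ (1 / (d : ℝ)) +
        (idealMultiplicity d J : ℝ) ^ (1 / (d : ℝ)) := by
  have hI' := hI.isCofinite
  have hJ' := hJ.isCofinite
  obtain ⟨c, hc⟩ := exists_hasBinomialCoeffs d hdim hI' hJ'
  have hpos := hasBinomialCoeffs_pos d hdim hI' hJ' hc
  have hB := hc.isBhattacharyaPolynomial hI' hJ'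
  have hmix : ∀ i ≤ d, mixedMultiplicity d I J i = c (d - i) i := fun i hi =>
    hc.mixedMultiplicity_eq hI' hJ' hi
  have heI : idealMultiplicity d I = c d 0 := hc.idealMultiplicity_eq hdim hI' hJ'
  have heJ : idealMultiplicity d J = c 0 d := hc.swap.idealMultiplicity_eq hdim hJ' hI'
  have hmpos : ∀ i ≤ d, 0 < mixedMultiplicity d I J i := fun i hi =>
    hmix i hi ▸ hpos _ _ (by omega)
  have hsq : ∀ i, i + 2 ≤ d → mixedMultiplicity d I J (i + 1) ^ 2 ≤
      mixedMultiplicity d I J i * mixedMultiplicity d I J (i + 2) := by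
    intro i hi
    obtain ⟨e, rfl⟩ := Nat.exists_eq_add_of_le' hi
    have := hasBinomialCoeffs_sq_le (e + i) hdim hI' hJ' hc e i rfl
    rw [hmix _ (by omega), hmix _ (by omega), hmix _ (by omega)]
    rwa [show e + (i + 2) - i = e + 2 by omega, show e + (i + 2) - (i + 1) = e + 1 by omega,
      show e + (i + 2) - (i + 2) = e by omega]
  have hbound : ∀ i ≤ d, mixedMultiplicity d I J i ^ d ≤
      idealMultiplicity d I ^ (d - i) * idealMultiplicity d J ^ i := by
    intro i hi
    have := pow_le_pow_mul_pow_of_sq_le hmpos hsq hi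
    rwa [hmix 0 (Nat.zero_le _), hmix d le_rfl, Nat.sub_zero, Nat.sub_self, ← heI, ← heJ] at this
  refine ⟨fun K hK => hilbertSamuelPolynomial_of_isCofinite hdim hK.isCofinite,
    hB.eq.symm ▸ hB, ?_, hmpos, fun i hi => ?_, hbound, ?_⟩
  · rw [hB.eq]
    exact binomialPolynomial_totalDegree hc.1 (hpos d 0 rfl).ne'
  · rw [div_le_div_iff₀ (hmpos _ (by omega)) (hmpos _ (by omega)), ← sq,
      mul_comm _ (mixedMultiplicity d I J i)]
    exact hsq i hi
  · rw [hc.idealMultiplicity_mul_eq hdim hI' hJ']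
    -- The sum is indexed by the exponent a = d - i of `r`, so the bound on mixed multiplicities is
    -- used at `d - a`.
    refine rpow_le_add_rpow (E := fun a => (c a (d - a) : ℝ)) (by omega) ?_ ?_
      (fun a ha => ?_) (fun a ha => ?_)
    · rw [heI]
      exact_mod_cast (hpos d 0 rfl).le
    · rw [heJ]
      exact_mod_cast (hpos 0 d (zero_add d)).le
    · exact_mod_cast (hpos a (d - a) (by omega)).le
    · have := hbound (d - a) (by omega)
      rw [hmix _ (by omega), Nat.sub_sub_self ha] at this
      exact_mod_cast this
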